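/- **Conventions.** $\mathfrak R^n$ is the set of compact $K\subset\mathbb R^n$ with $K^\circ$ connected, $0\in K^\circ$ and $K=\overline{K^\circ}$. A triangulation $\mathcal T=\{\sigma_i\}$ of a set $\Omega\in\mathfrak R^n$ is a finite collection of $n$-simplexes $\sigma_i=\mathrm{co}\{x_{i,0},\dots,x_{i,n}\}$ with union $\Omega$, any two of which meet in a common face or not at all. A function $V$ is CPA on $\mathcal T$ if it is affine on each $\sigma_i$; $\nabla V_i$ is its gradient there. For $p\in[1,2]$ put $$c_{i,j}=\tfrac n2\|x_{i,j}-x_{i,0}\|_p\Big(\max_{1\le k\le n}\|x_{i,k}-x_{i,0}\|_p+\|x_{i,j}-x_{i,0}\|_p\Big).$$ $\|\cdot\|_\infty$ of a matrix is the norm induced by the vector $\infty$-norm. "$B$ bounds the Hessian of $\varphi$ on $\sigma_i$" means that $\varphi$ is $C^2$ on the closed simplex $\sigma_i$ and all its second-order partial derivatives have absolute value at most $B$ there. **System.** Consider $\dot x=f(x)+G(x)u$, $y=h(x)$, with $x\in\mathcal X\in\mathfrak R^n$, $u(t)\in\mathbb R^m$, $y(t)\in\mathbb R^q$. Put $\bar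 g(x)=\|G(x)G(x)^\top\|_\infty$ and assume $f(0)=0$, $h(0)=0$, $\bar g(0)=0$. **Storage function.** Let $\Omega\in\mathfrak R^n$, $\Omega\subseteq\mathcal X$, have a triangulation $\mathcal T=\{\sigma_i\}$ with $x_{i,0}=0$ whenever $0\in\sigma_i$, such that $f,G,h$ are $C^2$ on each closed simplex $\sigma_i$. Let $V$ be CPA on $\mathcal T$, and let $l_i\in\mathbb R^n$, $\gamma>0$, $b_1>0$ and $\beta_i,\tilde\beta_i,\bar\beta_i$ be such that, on each $\sigma_i$, $\beta_i$ bounds the Hessian of every component of $f$, $\tilde\beta_i$ that of $h^\top h$, and $\bar\beta_i$ that of $\bar g$; $V\ge0$ at all vertices; $|\nabla V_i|\le l_i$ componentwise; and at all vertices $x_{i,j}\ne0$ $$f(x_{i,j})^\top\nabla V_i+\tfrac12\|h(x_{i,j})\|_2^2+\big(1_n^\top l_i\,\beta_i+\tfrac12\tilde\beta_i\big)c_{i,j}+\tfrac1{2\gamma}\big(\bar g(x_{i,j})+\bar\beta_ic_{i,j}\big)(1_n^\top l_i)^2\le-b_1 .$$ **Barrier function.** Let $\hat\Omega\in\mathfrak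 R^n$, $\hat\Omega\subseteq\mathcal X$, have a triangulation $\hat{\mathcal T}=\{\hat\sigma_i\}$, with vertices $\hat x_{i,j}$ and corresponding numbers $\hat c_{i,j}$. Let $\mathcal A_1\in\mathfrak R^n$ with $\partial\mathcal A_1\subseteq\bigcup_i\partial\hat\sigma_i$. Let $W$ be CPA on $\hat{\mathcal T}$, and let $\hat l_i\in\mathbb R^n$, $\hat u>0$, $b_2>0$ and $\hat\beta_i$ be such that $\hat\beta_i$ bounds the Hessian of every component of $f$ on $\hat\sigma_i$; $\hat g_i=\max_{x\in\hat\sigma_i}\|G(x)\|_\infty$ exists; $W>0$ at all vertices; $|\nabla W_i|\le\hat l_i$ componentwise; and, for every $i$ with $\hat\sigma_i\not\subseteq\mathcal A_1$ and every $j$, $$f(\hat x_{i,j})^\top\nabla W_i+(1_n^\top\hat l_i)\big(\hat\beta_i\hat c_{i,j}+\hat g_i\hat u\big)\le-b_2 .$$ Let $\mathcal A=\{x\in\hat\Omega: W(x)\le c\}$ be a sublevel set of $W$ with $W=c$ on $\partial\mathcal A$, $\mathcal A_1\subseteq\mathcal A$, $\mathcal A_1\subseteq\hat\Omega^\circ$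 and $\mathcal A\subseteq\Omega$. **Conclusion.** The system is small-signal finite-gain $\mathcal L_2$ stable in $\mathcal A^\circ$, for inputs bounded by $\hat u$, with $\mathcal L_2$ gain at most $\sqrt\gamma$. That is, for every $x_0\in\mathcal A^\circ$ and $u\in\mathcal L_{2e}^m$: (i) if $\|u(t)\|_\infty\le\hat u$ for all $t\ge0$, then there is an (absolutely continuous) solution on $[0,\infty)$ with $x(0)=x_0$ and values in $\mathcal X$; (ii) for every $\tau\ge0$ with $\sup_{0\le t\le\tau}\|u(t)\|_\infty\le\hat u$ and every solution on $[0,\tau]$ with $x(0)=x_0$ and values in $\mathcal X$, the output is square integrable on $[0,\tau]$ and $$\Big(\int_0^\tau\|y\|_2^2\,dt\Big)^{1/2}\le\sqrt\gamma\,\Big(\int_0^\tau\|u\|_2^2\,dt\Big)^{1/2}+\sqrt{2V(x_0)} .$$ -/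

import Mathlib

open Set MeasureTheory
open scoped ENNReal Matrix

noncomputable section

/-! Points of `ℝⁿ` are functions `Fin n → ℝ`; the built-in norm on this type is the `∞`-norm.
Other norms are written explicitly through `WithLp`. -/

/-- The `p`-norm of a vector. -/
def vecNorm (p : ℝ≥0∞) {n : ℕ} (v : Fin n → ℝ) : ℝ :=
  ‖(WithLp.toLp p v : PiLp p (fun _ : Fin n => ℝ))‖

/-- The matrix norm induced by the `∞`-norms on `ℝᵐ` and `ℝᵏ`. -/
def matNormInf {k m : ℕ} (A : Matrix (Fin k) (Fin m) ℝ) : ℝ :=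
  ‖LinearMap.toContinuousLinearMap A.mulVecLin‖

/-- Compact sets with connected interior containing the origin, equal to the closure of their
interior. -/
structure IsRegularRegion {n : ℕ} (K : Set (Fin n → ℝ)) : Prop where
  compact : IsCompact K
  connected : IsConnected (interior K)
  zero_mem : (0 : Fin n → ℝ) ∈ interior K
  closure_eq : closure (interior K) = K

/-! ### Triangulations and continuous piecewise affine functions -/

/-- A finite collection of `n`-simplexes in `ℝⁿ`, with an ordering of the vertices of each,
any two of which intersect in the (possibly empty) face spanned by their common vertices. -/
structure Triangulation (n : ℕ) where
  /-- the number of simplexes -/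
  N : ℕ
  /-- `vert i j` is the vertex number `j` of the simplex number `i` -/
  vert : Fin N → Fin (n + 1) → (Fin n → ℝ)
  affineIndependent : ∀ i, AffineIndependent ℝ (vert i)
  inter_eq : ∀ i k, convexHull ℝ (range (vert i)) ∩ convexHull ℝ (range (vert k)) =
    convexHull ℝ (range (vert i) ∩ range (vert k))

namespace Triangulation

variable {n : ℕ} (T : Triangulation n)

/-- The simplex number `i`. -/
def simplex (i : Fin T.N) : Set (Fin n → ℝ) := convexHull ℝ (range (T.vert i))

/-- The union of all simplexes. -/
def carrier : Set (Fin n → ℝ) := ⋃ i, T.simplex i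

/-- If a simplex contains the origin, then its vertex number `0` is the origin. -/
def BasedAtOrigin : Prop := ∀ i, (0 : Fin n → ℝ) ∈ T.simplex i → T.vert i 0 = 0

/-- The matrix whose rows are `x_{i,j} - x_{i,0}`, `j = 1, …, n`. -/
def edgeMatrix (i : Fin T.N) : Matrix (Fin n) (Fin n) ℝ :=
  Matrix.of fun j => T.vert i j.succ - T.vert i 0

/-- The gradient, on the simplex number `i`, of the affine interpolation of the vertex values
of `V`. -/
def grad (V : (Fin n → ℝ) → ℝ) (i : Fin T.N) : Fin n → ℝ :=
  (T.edgeMatrix i)⁻¹ *ᵥ fun j => V (T.vert i j.succ) - V (T.vert i 0)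

/-- `V` is, on the union of the simplexes, the continuous piecewise affine interpolation of
its vertex values. -/
def IsCPA (V : (Fin n → ℝ) → ℝ) : Prop :=
  ∀ i, ∀ x ∈ T.simplex i, V x = V (T.vert i 0) + T.grad V i ⬝ᵥ (x - T.vert i 0)

/-- `c_{i,j} = (n/2) ‖x_{i,j} - x_{i,0}‖ (max_k ‖x_{i,k} - x_{i,0}‖ + ‖x_{i,j} - x_{i,0}‖)`. -/
def errCoeff (p : ℝ≥0∞) (i : Fin T.N) (j : Fin (n + 1)) : ℝ :=
  (n : ℝ) / 2 * vecNorm p (T.vert i j - T.vert i 0) *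
    ((⨆ k : Fin n, vecNorm p (T.vert i k.succ - T.vert i 0)) +
      vecNorm p (T.vert i j - T.vert i 0))

/-- `φ` is twice continuously differentiable on every (closed) simplex. -/
def PiecewiseC2 (φ : (Fin n → ℝ) → ℝ) : Prop := ∀ i, ContDiffOn ℝ 2 φ (T.simplex i)

end Triangulation

/-- `φ` is `C²` on `s`, and its second-order partial derivatives are bounded by `B` there. -/
def IsHessianBound {n : ℕ} (φ : (Fin n → ℝ) → ℝ) (s : Set (Fin n → ℝ)) (B : ℝ) : Prop :=
  ContDiffOn ℝ 2 φ s ∧ ∀ ξ ∈ s, ∀ q r : Fin n,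
    |iteratedFDerivWithin ℝ 2 φ s ξ ![Pi.single q 1, Pi.single r 1]| ≤ B

/-! ### Signals -/

/-- The truncation of a signal to `[0, τ]`, with values in Euclidean space. -/
def truncSignal {m : ℕ} (τ : ℝ) (u : ℝ → Fin m → ℝ) : ℝ → EuclideanSpace ℝ (Fin m) :=
  (Icc 0 τ).indicator fun t => WithLp.toLp 2 (u t)

/-- The extended space `L²_e`. -/
def MemL2e {m : ℕ} (u : ℝ → Fin m → ℝ) : Prop :=
  ∀ τ : ℝ, 0 ≤ τ → MemLp (truncSignal τ u) 2 volume

/-- The `L²` norm of the truncation of a signal. -/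
def truncL2Norm {m : ℕ} (τ : ℝ) (u : ℝ → Fin m → ℝ) : ℝ :=
  (eLpNorm (truncSignal τ u) 2 volume).toReal

/-! ### Control-affine systems -/

/-- The system `ẋ = f(x) + G(x) u`, `y = h(x)` with the state constraint `x ∈ X`.
Values of `f`, `G`, `h` outside `X` play no role. -/
structure ControlAffineSystem (n m q : ℕ) where
  X : Set (Fin n → ℝ)
  f : (Fin n → ℝ) → (Fin n → ℝ)
  G : (Fin n → ℝ) → Matrix (Fin n) (Fin m) ℝ
  h : (Fin n → ℝ) → (Fin q → ℝ)

namespace ControlAffineSystem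

variable {n m q : ℕ} (S : ControlAffineSystem n m q)

/-- `ḡ(x) = ‖G(x) G(x)ᵀ‖_∞`. -/
def gBar (x : Fin n → ℝ) : ℝ := matNormInf (S.G x * (S.G x)ᵀ)

/-- `x` is an (absolutely continuous, i.e. Carathéodory) solution on `[0, τ]` with initial
state `x₀` and input `u`. -/
structure IsSolution (x₀ : Fin n → ℝ) (u : ℝ → Fin m → ℝ) (τ : ℝ) (x : ℝ → Fin n → ℝ) :
    Prop where
  mem : ∀ t ∈ Icc 0 τ, x t ∈ S.X
  integrable : IntervalIntegrable (fun s => S.f (x s) + S.G (x s) *ᵥ u s) volume 0 τ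
  eq : ∀ t ∈ Icc 0 τ, x t = x₀ + ∫ s in (0 : ℝ)..t, (S.f (x s) + S.G (x s) *ᵥ u s)

/-- Small-signal finite-gain `L²` stability from the initial state `x₀`, for inputs of
`∞`-norm at most `r`, with gain at most `g` and bias `b`: such inputs admit a solution for all
times, and for every solution the output is in `L²_e` and satisfies the gain inequality. -/
def SmallSignalL2Stable (x₀ : Fin n → ℝ) (r g b : ℝ) : Prop :=
  (∀ u : ℝ → Fin m → ℝ, MemL2e u → (∀ t, 0 ≤ t → ‖u t‖ ≤ r) →
    ∃ x : ℝ → Fin n → ℝ, ∀ τ, 0 ≤ τ → S.IsSolution x₀ u τ x) ∧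
  ∀ u : ℝ → Fin m → ℝ, MemL2e u → ∀ τ : ℝ, 0 ≤ τ → (∀ t ∈ Icc 0 τ, ‖u t‖ ≤ r) →
    ∀ x : ℝ → Fin n → ℝ, S.IsSolution x₀ u τ x →
      MemLp (truncSignal τ fun t => S.h (x t)) 2 volume ∧
      truncL2Norm τ (fun t => S.h (x t)) ≤ g * truncL2Norm τ u + b

/-- The expression `H_{i,j}`. -/
def hjTerm (T : Triangulation n) (p : ℝ≥0∞) (V : (Fin n → ℝ) → ℝ) (l : Fin T.N → Fin n → ℝ)
    (β βh βg : Fin T.N → ℝ) (γ : ℝ) (i : Fin T.N) (j : Fin (n + 1)) : ℝ :=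
  S.f (T.vert i j) ⬝ᵥ T.grad V i
    + 1 / 2 * vecNorm 2 (S.h (T.vert i j)) ^ 2
    + ((∑ k, l i k) * β i + 1 / 2 * βh i) * T.errCoeff p i j
    + 1 / (2 * γ) * (S.gBar (T.vert i j) + βg i * T.errCoeff p i j) * (∑ k, l i k) ^ 2

/-- The conditions on a CPA storage function `V` on the triangulation `T`. -/
structure StorageConditions (T : Triangulation n) (p : ℝ≥0∞) (V : (Fin n → ℝ) → ℝ)
    (l : Fin T.N → Fin n → ℝ) (β βh βg : Fin T.N → ℝ) (γ b₁ : ℝ) : Prop where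
  cpa : T.IsCPA V
  f_bound : ∀ i k, IsHessianBound (fun x => S.f x k) (T.simplex i) (β i)
  h_bound : ∀ i, IsHessianBound (fun x => S.h x ⬝ᵥ S.h x) (T.simplex i) (βh i)
  g_bound : ∀ i, IsHessianBound S.gBar (T.simplex i) (βg i)
  gamma_pos : 0 < γ
  nonneg : ∀ i j, 0 ≤ V (T.vert i j)
  grad_le : ∀ i k, |T.grad V i k| ≤ l i k
  hj_le : ∀ i j, T.vert i j ≠ 0 → S.hjTerm T p V l β βh βg γ i j ≤ -b₁

/-- The conditions on a CPA barrier function `W` on the triangulation `T`: a decrease is imposed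
on the simplexes which are not contained in `A₁`. Here `gmax i` is the maximum of `‖G‖_∞` over
the simplex number `i`. -/
structure BarrierConditions (T : Triangulation n) (p : ℝ≥0∞) (A₁ : Set (Fin n → ℝ))
    (W : (Fin n → ℝ) → ℝ) (l : Fin T.N → Fin n → ℝ) (β gmax : Fin T.N → ℝ) (b₂ uMax : ℝ) :
    Prop where
  cpa : T.IsCPA W
  f_bound : ∀ i k, IsHessianBound (fun x => S.f x k) (T.simplex i) (β i)
  gmax_isGreatest : ∀ i, IsGreatest ((fun x => matNormInf (S.G x)) '' T.simplex i) (gmax i)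
  uMax_pos : 0 < uMax
  pos : ∀ i j, 0 < W (T.vert i j)
  grad_le : ∀ i k, |T.grad W i k| ≤ l i k
  decrease : ∀ i, ¬ T.simplex i ⊆ A₁ → ∀ j,
    S.f (T.vert i j) ⬝ᵥ T.grad W i
      + (∑ k, l i k) * (β i * T.errCoeff p i j + gmax i * uMax) ≤ -b₂

end ControlAffineSystem

end

/-!
The storage function `V` and the barrier function `W` are affine on each simplex, and the conditions
at the vertices extend to whole simplexes: for `φ` with Hessian entries at most `B`, the affine
interpolation of the vertex values is off by at most `B ∑ⱼ wⱼ c_{i,j}` at the point with barycentric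
coordinates `wⱼ` (`IsHessianBound.abs_sub_sum_le`). Hence, for admissible `u`,

* `∇V_i · (f + G u) ≤ (γ/2) |u|² - (1/2) |h|²` on every simplex of the first triangulation
  (`StorageConditions.dotProduct_le`);
* `∇W_i · (f + G u) ≤ -b₂` on every simplex of the second one which is not contained in `A₁`
  (`BarrierConditions.dotProduct_le`).

A CPA function is not differentiable, but along an absolutely continuous curve it is absolutely
continuous, and at almost every time its derivative is `∇V_i · ẋ` for some simplex containing `x`
(`image_sub_le_integral`). So the pointwise inequalities can be integrated.

For `W` this makes `A` invariant (`Triangulation.IsCPA.mem_sublevel`): a boundary point of `A`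
outside `A₁` cannot be reached, since `W` would have decreased strictly to its maximum `c` on `A`; past
a boundary point in `A₁`, which is interior to the domain of `W`, a curve outside `A` meets only
simplexes on which `W` decreases, so `W` cannot rise above `c`. For `V` it gives the gain inequality
(`StorageConditions.gain`), because `A` lies in the domain of `V`.

Uniqueness of solutions is not needed. Existence comes from Carathéodory's theorem
(`exists_caratheodory_solution`) for bounded continuous extensions of `f` and `G`. The field `G` may
be discontinuous outside the domain of `V`, so an extension need not agree with it near the boundary
of `A`; however, the decrease of `W` being strict on the boundary points in `A₁`, it persists nearby
for the extended fields, and `A` is invariant for them as well.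
-/

open Filter Topology

/-! ### Piecewise affine functions along absolutely continuous curves -/

theorem AbsolutelyContinuousOnInterval.of_dist_le {X Y : Type*} [PseudoMetricSpace X]
    [PseudoMetricSpace Y] {f : ℝ → X} {g : ℝ → Y} {a b : ℝ}
    (hg : AbsolutelyContinuousOnInterval g a b)
    (h : ∀ s ∈ uIcc a b, ∀ t ∈ uIcc a b, dist (f s) (f t) ≤ dist (g s) (g t)) :
    AbsolutelyContinuousOnInterval f a b := by
  refine squeeze_zero' (Eventually.of_forall fun E => Finset.sum_nonneg fun _ _ => dist_nonneg)
    ?_ hg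
  filter_upwards [mem_inf_of_right (mem_principal_self _)] with E hE
  exact Finset.sum_le_sum fun i hi => h _ (hE.1 i hi).1 _ (hE.1 i hi).2

/-- Near `t`, a curve visits only those members of a finite family of closed sets which contain
its position at time `t`. -/
theorem eventually_mem_imp_mem {E ι : Type*} [TopologicalSpace E] [Finite ι]
    {σ : ι → Set E} (hσ : ∀ i, IsClosed (σ i)) {x : ℝ → E} {s : Set ℝ}
    {t : ℝ} (hx : ContinuousWithinAt x s t) :
    ∀ᶠ r in 𝓝[s] t, ∀ i, x r ∈ σ i → x t ∈ σ i := by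
  rw [eventually_all]
  intro i
  by_cases h : x t ∈ σ i
  · exact Eventually.of_forall fun _ _ => h
  · filter_upwards [hx ((hσ i).isOpen_compl.mem_nhds h)] with r hr hr'
    exact absurd hr' hr

section PiecewiseAffine

variable {E ι : Type*} [NormedAddCommGroup E] [NormedSpace ℝ E] [Finite ι]

/-- A function with gradient `p i` on the closed set `σ i` has, along a curve with velocity `v`
staying in the union of the finitely many sets `σ i`, an increment of at most `∫ r` as soon as
the velocity satisfies `p i (v s) ≤ r s` for every `i` such that `x s ∈ σ i`. At almost every time
the function and the curve are both differentiable along the curve, and one of the sets is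
visited at times accumulating from the right, which identifies the derivative as `p i (v s)`. -/
theorem image_sub_le_integral [CompleteSpace E] {σ : ι → Set E} (hσ : ∀ i, IsClosed (σ i))
    {U : E → ℝ} {p : ι → E →L[ℝ] ℝ}
    (hU : ∀ i, ∀ z ∈ σ i, ∀ w ∈ σ i, U w - U z = p i (w - z)) {a b : ℝ} (hab : a ≤ b)
    {x v : ℝ → E} (hv : IntervalIntegrable v volume a b)
    (hx : ∀ t ∈ Icc a b, x t = x a + ∫ s in a..t, v s)
    (hmem : ∀ t ∈ Icc a b, ∃ i, x t ∈ σ i) {r : ℝ → ℝ} (hr : IntervalIntegrable r volume a b)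
    (hrate : ∀ᵐ s, s ∈ Ioo a b → ∀ i, x s ∈ σ i → p i (v s) ≤ r s) :
    U (x b) - U (x a) ≤ ∫ s in a..b, r s := by
  have := Fintype.ofFinite ι
  have hsub : ∀ {s t}, s ∈ Icc a b → t ∈ Icc a b → IntervalIntegrable v volume s t := fun hs ht =>
    hv.mono_set (by rw [uIcc_of_le hab]; exact ordConnected_Icc.uIcc_subset hs ht)
  have hincr : ∀ s ∈ Icc a b, ∀ t ∈ Icc a b, x t - x s = ∫ r in s..t, v r := by
    intro s hs t ht
    rw [hx t ht, hx s hs, add_sub_add_left_eq_sub, intervalIntegral.integral_interval_sub_left]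
    · exact hsub (left_mem_Icc.2 hab) ht
    · exact hsub (left_mem_Icc.2 hab) hs
  have hxc : ContinuousOn x (Icc a b) := by
    have h1 := (intervalIntegral.continuousOn_primitive_interval'
      (a := a) hv left_mem_uIcc).const_add (x a)
    rw [uIcc_of_le hab] at h1
    exact h1.congr hx
  set L : ℝ := ∑ i, ‖p i‖ with hL
  have hpL : ∀ i, ‖p i‖ ≤ L := fun i =>
    Finset.single_le_sum (f := fun i => ‖p i‖) (fun _ _ => norm_nonneg _) (Finset.mem_univ i)
  have hL0 : 0 ≤ L := Finset.sum_nonneg fun _ _ => norm_nonneg _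
  have hloc : ∀ t ∈ Icc a b, ∀ᶠ s in 𝓝[Icc a b] t, ∃ i, x s ∈ σ i ∧ x t ∈ σ i := by
    intro t ht
    filter_upwards [eventually_mem_imp_mem hσ (hxc t ht), self_mem_nhdsWithin] with s hs hs'
    obtain ⟨i, hi⟩ := hmem s hs'
    exact ⟨i, hi, hs i hi⟩
  have hdist : ∀ {s t i}, x s ∈ σ i → x t ∈ σ i → |U (x t) - U (x s)| ≤ L * ‖x t - x s‖ := by
    intro s t i hs ht
    rw [hU i _ hs _ ht]
    exact ((p i).le_opNorm _).trans (mul_le_mul_of_nonneg_right (hpL i) (norm_nonneg _))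
  have hyc : ContinuousOn (fun t => U (x t)) (Icc a b) := by
    intro t ht
    rw [ContinuousWithinAt, tendsto_iff_norm_sub_tendsto_zero]
    have h1 : Tendsto (fun s => L * ‖x s - x t‖) (𝓝[Icc a b] t) (𝓝 0) := by
      have := (tendsto_iff_norm_sub_tendsto_zero.1 (hxc t ht)).const_mul L
      simpa using this
    refine squeeze_zero' (Eventually.of_forall fun _ => norm_nonneg _) ?_ h1
    filter_upwards [hloc t ht] with s ⟨i, hs, ht⟩
    exact hdist ht hs
  have hvn : IntervalIntegrable (fun s => L * ‖v s‖) volume a b := hv.norm.const_mul L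
  have hnsub : ∀ {s t}, s ∈ Icc a b → t ∈ Icc a b →
      IntervalIntegrable (fun s => L * ‖v s‖) volume s t := fun hs ht =>
    hvn.mono_set (by rw [uIcc_of_le hab]; exact ordConnected_Icc.uIcc_subset hs ht)
  set M : ℝ → ℝ := fun t => ∫ s in a..t, L * ‖v s‖ with hM
  have hMac : AbsolutelyContinuousOnInterval M a b :=
    hvn.absolutelyContinuousOnInterval_intervalIntegral left_mem_uIcc
  have hMc : ContinuousOn M (Icc a b) := by
    have := hMac.continuousOn
    rwa [uIcc_of_le hab] at this
  have hMincr : ∀ s ∈ Icc a b, ∀ t ∈ Icc a b, M t - M s = ∫ r in s..t, L * ‖v r‖ := by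
    intro s hs t ht
    exact intervalIntegral.integral_interval_sub_left (hnsub (left_mem_Icc.2 hab) ht)
      (hnsub (left_mem_Icc.2 hab) hs)
  have hxM : ∀ s ∈ Icc a b, ∀ t ∈ Icc a b, s ≤ t → L * ‖x t - x s‖ ≤ M t - M s := by
    intro s hs t ht hst
    rw [hMincr s hs t ht, hincr s hs t ht, intervalIntegral.integral_const_mul]
    exact mul_le_mul_of_nonneg_left (intervalIntegral.norm_integral_le_integral_norm hst) hL0
  have hyM : ∀ s ∈ Icc a b, ∀ t ∈ Icc a b, s ≤ t → |U (x t) - U (x s)| ≤ M t - M s := by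
    intro s hs t ht hst
    have hsubset : Icc s b ⊆ Icc a b := Icc_subset_Icc_left hs.1
    have key : Icc s b ⊆ {t | |U (x t) - U (x s)| ≤ M t - M s} := by
      refine IsClosed.Icc_subset_of_forall_exists_gt ?_ (by simp) ?_
      · have h1 : ContinuousOn (fun t => |U (x t) - U (x s)|) (Icc s b) :=
          ((hyc.mono hsubset).sub continuousOn_const).abs
        have h2 : ContinuousOn (fun t => M t - M s) (Icc s b) :=
          (hMc.mono hsubset).sub continuousOn_const
        have := isClosed_Icc.isClosed_le h1 h2
        rwa [inter_comm]
      · rintro t ⟨ht, hts⟩ w hw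
        have ht' : t ∈ Icc a b := hsubset (Ico_subset_Icc_self hts)
        have hIoc : Ioc t (min w b) ∈ 𝓝[>] t := Ioc_mem_nhdsGT (lt_min hw hts.2)
        have hle : 𝓝[>] t ≤ 𝓝[Icc a b] t := by
          rw [← nhdsWithin_Ioc_eq_nhdsGT hts.2]
          exact nhdsWithin_mono _ (Ioc_subset_Icc_self.trans (Icc_subset_Icc_left ht'.1))
        obtain ⟨t', ht1, i, hi1, hi2⟩ := ((eventually_of_mem hIoc fun _ h => h).and
          (hle (hloc t ht'))).exists
        have ht1' : t' ∈ Icc a b := ⟨ht'.1.trans ht1.1.le, ht1.2.trans (min_le_right _ _)⟩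
        refine ⟨t', ?_, ht1.1, ht1.2.trans (min_le_left _ _)⟩
        have h3 := (hdist hi2 hi1).trans (hxM t ht' t' ht1' ht1.1.le)
        have h4 := abs_sub_le (U (x t')) (U (x t)) (U (x s))
        have h5 : |U (x t) - U (x s)| ≤ M t - M s := ht
        change |U (x t') - U (x s)| ≤ M t' - M s
        linarith
    exact key ⟨hst, ht.2⟩
  have hyac : AbsolutelyContinuousOnInterval (fun t => U (x t)) a b := by
    refine hMac.of_dist_le fun s hs t ht => ?_
    rw [uIcc_of_le hab] at hs ht
    rcases le_total s t with hst | hst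
    · rw [dist_comm, dist_comm (M s), Real.dist_eq, Real.dist_eq]
      exact (hyM s hs t ht hst).trans (le_abs_self _)
    · rw [Real.dist_eq, Real.dist_eq]
      exact (hyM t ht s hs hst).trans (le_abs_self _)
  rw [← hyac.integral_deriv_eq_sub]
  refine intervalIntegral.integral_mono_ae_restrict hab hyac.intervalIntegrable_deriv hr ?_
  rw [EventuallyLE, ← restrict_Ioo_eq_restrict_Icc, ae_restrict_iff' measurableSet_Ioo]
  filter_upwards [hyac.ae_differentiableAt, hv.ae_hasDerivAt_integral, hrate] with t h1 h2 h3 ht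
  have htI : t ∈ Icc a b := Ioo_subset_Icc_self ht
  have htu : t ∈ uIcc a b := by rwa [uIcc_of_le hab]
  have hxd : HasDerivAt x (v t) t := by
    refine ((h2 htu a left_mem_uIcc).const_add (x a)).congr_of_eventuallyEq ?_
    filter_upwards [Icc_mem_nhds ht.1 ht.2] with s hs using hx s hs
  have hyd := (h1 htu).hasDerivAt
  have hle : 𝓝[>] t ≤ 𝓝[Icc a b] t := by
    rw [← nhdsWithin_Ioc_eq_nhdsGT ht.2]
    exact nhdsWithin_mono _ (Ioc_subset_Icc_self.trans (Icc_subset_Icc_left htI.1))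
  obtain ⟨i, hi⟩ : ∃ i, ∃ᶠ s in 𝓝[>] t, x s ∈ σ i ∧ x t ∈ σ i := by
    by_contra! hcon
    obtain ⟨s, hs', i, hs⟩ := ((eventually_all.2 hcon).and (hle (hloc t htI))).exists
    exact hs' i hs.1 hs.2
  have hxt : x t ∈ σ i := hi.exists.choose_spec.2
  have e1 : Tendsto (slope (fun t => U (x t)) t) (𝓝[>] t) (𝓝 (deriv (fun t => U (x t)) t)) :=
    (hasDerivAt_iff_tendsto_slope.1 hyd).mono_left (nhdsWithin_mono _ fun s hs => ne_of_gt hs)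
  have e2 : Tendsto (slope (fun t => p i (x t)) t) (𝓝[>] t) (𝓝 (p i (v t))) :=
    (hasDerivAt_iff_tendsto_slope.1 ((p i).hasFDerivAt.comp_hasDerivAt t hxd)).mono_left
      (nhdsWithin_mono _ fun s hs => ne_of_gt hs)
  have e3 : deriv (fun t => U (x t)) t = p i (v t) := by
    refine tendsto_nhds_unique_of_frequently_eq e1 e2 (hi.mono fun s hs => ?_)
    simp only [slope, vsub_eq_sub]
    rw [hU i _ hs.2 _ hs.1, map_sub]
  rw [e3]
  exact h3 ht i hxt

end PiecewiseAffine

/-! ### Existence of Carathéodory solutions -/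

/-- A sequence of uniformly Lipschitz curves issued from one point has a subsequence converging
pointwise: extract a subsequence converging at the rational times. -/
theorem exists_subseq_tendsto_of_lipschitz {E : Type*} [NormedAddCommGroup E]
    [ProperSpace E] {z : ℕ → ℝ → E} {K : ℝ} (hK : 0 ≤ K)
    (hz : ∀ k s t, ‖z k t - z k s‖ ≤ K * |t - s|) {x₀ : E} (hz0 : ∀ k, z k 0 = x₀) :
    ∃ (φ : ℕ → ℕ) (x : ℝ → E), StrictMono φ ∧
      ∀ t, Tendsto (fun k => z (φ k) t) atTop (𝓝 (x t)) := by
  have hcomp : IsCompact (Set.pi univ fun q : ℚ => Metric.closedBall x₀ (K * |(q : ℝ)|)) :=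
    isCompact_univ_pi fun q => isCompact_closedBall _ _
  obtain ⟨a, -, φ, hφ, ha⟩ := hcomp.tendsto_subseq (x := fun k (q : ℚ) => z k q) fun k q _ => by
    have := hz k 0 q
    rw [hz0, sub_zero] at this
    rwa [mem_closedBall_iff_norm]
  have hconv : ∀ t, ∃ x, Tendsto (fun k => z (φ k) t) atTop (𝓝 x) := by
    intro t
    refine cauchySeq_tendsto_of_complete (Metric.cauchySeq_iff.2 fun ε hε => ?_)
    obtain ⟨q, hq1, hq2⟩ := exists_rat_btwn (show t < t + ε / (4 * (K + 1)) by
      have : 0 < ε / (4 * (K + 1)) := by positivity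
      linarith)
    have hqt : K * |t - q| ≤ ε / 4 := by
      have h1 : |t - q| ≤ ε / (4 * (K + 1)) := by
        rw [abs_sub_comm, abs_of_pos (sub_pos.2 hq1)]; linarith
      calc K * |t - q| ≤ (K + 1) * (ε / (4 * (K + 1))) := by gcongr; linarith
        _ = ε / 4 := by field_simp
    have hc : CauchySeq fun k => z (φ k) q := ((tendsto_pi_nhds.1 ha) q).cauchySeq
    obtain ⟨N, hN⟩ := Metric.cauchySeq_iff.1 hc (ε / 4) (by positivity)
    refine ⟨N, fun m hm k hk => ?_⟩
    have h1 := (hz (φ m) q t).trans hqt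
    have h2 := (hz (φ k) q t).trans hqt
    have h3 := hN m hm k hk
    rw [← dist_eq_norm] at h1 h2
    rw [dist_comm] at h2
    have := dist_triangle4 (z (φ m) t) (z (φ m) q) (z (φ k) q) (z (φ k) t)
    linarith
  choose x hx using hconv
  exact ⟨φ, x, hφ, hx⟩

section Caratheodory

variable {E : Type*} [NormedAddCommGroup E] [NormedSpace ℝ E]

/-- Tonelli's approximation: a solution on `[0, τ]` of the equation with delay `δ`, extended by a
constant to the negative half-line. The Picard iterates of the delay equation become stationary on
`(-∞, jδ]` after `j` steps, so one of them is the solution sought. -/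
theorem exists_delay_solution {F : ℝ → E → E} {K : ℝ} (hK : ∀ t x, ‖F t x‖ ≤ K)
    (hFm : ∀ y : ℝ → E, Continuous y → AEStronglyMeasurable (fun s => F s (y s)) volume)
    (x₀ : E) {δ : ℝ} (hδ : 0 < δ) (τ : ℝ) :
    ∃ z : ℝ → E, (∀ s t, ‖z t - z s‖ ≤ K * |t - s|) ∧ z 0 = x₀ ∧
      ∀ t ∈ Icc 0 τ, z t = x₀ + ∫ s in (0 : ℝ)..t, F s (z (s - δ)) := by
  have hK0 : 0 ≤ K := (norm_nonneg _).trans (hK 0 x₀)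
  let y : ℕ → ℝ → E := fun j => Nat.rec (fun _ => x₀)
    (fun _ y t => x₀ + ∫ s in (0 : ℝ)..(max t 0), F s (y (s - δ))) j
  have y_succ : ∀ j t, y (j + 1) t = x₀ + ∫ s in (0 : ℝ)..(max t 0), F s (y j (s - δ)) :=
    fun j t => rfl
  have hlip : ∀ j s t, ‖y j t - y j s‖ ≤ K * |t - s| := by
    intro j
    induction j with
    | zero => intro s t; simpa [y] using mul_nonneg hK0 (abs_nonneg _)
    | succ j ih =>
      intro s t
      have hyc : Continuous (y j) := by
        have : LipschitzWith K.toNNReal (y j) := LipschitzWith.of_dist_le_mul fun a b => by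
          rw [dist_eq_norm, Real.dist_eq, Real.coe_toNNReal _ hK0]
          exact ih b a
        exact this.continuous
      have hint : ∀ a b, IntervalIntegrable (fun s => F s (y j (s - δ))) volume a b := by
        intro a b
        refine (intervalIntegrable_const (c := K)).mono_fun
          ((hFm _ (hyc.comp (continuous_id.sub continuous_const))).restrict) ?_
        exact Eventually.of_forall fun s => by
          simpa [abs_of_nonneg hK0] using hK s (y j (s - δ))
      rw [y_succ, y_succ, add_sub_add_left_eq_sub,
        intervalIntegral.integral_interval_sub_left (hint _ _) (hint _ _)]
      refine (intervalIntegral.norm_integral_le_of_norm_le_const fun s _ => hK _ _).trans ?_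
      exact mul_le_mul_of_nonneg_left (abs_max_sub_max_le_abs t s 0) hK0
  have hstat : ∀ j : ℕ, ∀ t ≤ j * δ, y (j + 1) t = y j t := by
    intro j
    induction j with
    | zero =>
      intro t ht
      have : max t 0 = 0 := max_eq_right (by simpa using ht)
      rw [y_succ, this, intervalIntegral.integral_same, add_zero]
      rfl
    | succ j ih =>
      intro t ht
      rw [y_succ (j + 1), y_succ j]
      congr 1
      refine intervalIntegral.integral_congr fun s hs => ?_
      rw [uIcc_of_le (le_max_right _ _)] at hs
      have h1 : max t 0 ≤ ((j + 1 : ℕ) : ℝ) * δ := max_le ht (by positivity)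
      have h2 : s - δ ≤ j * δ := by
        have := hs.2.trans h1
        push_cast at this
        linarith
      simp only [ih _ h2]
  obtain ⟨j, hj⟩ := exists_nat_ge (τ / δ)
  refine ⟨y (j + 1), hlip (j + 1), by simp [y_succ], fun t ht => ?_⟩
  rw [y_succ, max_eq_left ht.1]
  congr 1
  refine intervalIntegral.integral_congr fun s hs => ?_
  rw [uIcc_of_le ht.1] at hs
  have h1 : τ ≤ j * δ := (div_le_iff₀ hδ).1 hj
  have h2 : s - δ ≤ j * δ := by linarith [hs.2, ht.2]
  simp only [hstat _ _ h2]

/-- **Carathéodory's existence theorem**, on `[0, ∞)`, for a bounded right-hand side. -/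
theorem exists_caratheodory_solution [ProperSpace E] {F : ℝ → E → E} {K : ℝ}
    (hK : ∀ t x, ‖F t x‖ ≤ K) (hFc : ∀ t, Continuous (F t))
    (hFm : ∀ y : ℝ → E, Continuous y → AEStronglyMeasurable (fun s => F s (y s)) volume)
    (x₀ : E) :
    ∃ x : ℝ → E, Continuous x ∧ ∀ t, 0 ≤ t → x t = x₀ + ∫ s in (0 : ℝ)..t, F s (x s) := by
  have hK0 : 0 ≤ K := (norm_nonneg _).trans (hK 0 x₀)
  choose z hz hz0 hzeq using fun k : ℕ =>
    exists_delay_solution hK hFm x₀ (Nat.one_div_pos_of_nat (α := ℝ) (n := k)) k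
  obtain ⟨φ, x, hφ, hx⟩ := exists_subseq_tendsto_of_lipschitz hK0 hz hz0
  have hcont : ∀ {w : ℝ → E}, (∀ s t, ‖w t - w s‖ ≤ K * |t - s|) → Continuous w := by
    intro w hw
    have : LipschitzWith K.toNNReal w := LipschitzWith.of_dist_le_mul fun a b => by
      rw [dist_eq_norm, Real.dist_eq, Real.coe_toNNReal _ hK0]
      exact hw b a
    exact this.continuous
  have hxlip : ∀ s t, ‖x t - x s‖ ≤ K * |t - s| := fun s t =>
    le_of_tendsto ((hx t).sub (hx s)).norm (Eventually.of_forall fun k => hz _ s t)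
  refine ⟨x, hcont hxlip, fun t ht => ?_⟩
  have hδ : Tendsto (fun k => (1 : ℝ) / ((φ k : ℝ) + 1)) atTop (𝓝 0) :=
    tendsto_one_div_add_atTop_nhds_zero_nat.comp hφ.tendsto_atTop
  have hdelay : ∀ s, Tendsto (fun k => z (φ k) (s - 1 / ((φ k : ℝ) + 1))) atTop (𝓝 (x s)) := by
    intro s
    refine (hx s).congr_dist (squeeze_zero (fun _ => dist_nonneg) (fun k => ?_)
      (by simpa using hδ.const_mul K))
    have := hz (φ k) (s - 1 / ((φ k : ℝ) + 1)) s
    rw [sub_sub_cancel, abs_of_nonneg (by positivity)] at this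
    rwa [dist_eq_norm, ← one_div]
  have hlim : Tendsto (fun k => x₀ + ∫ s in (0 : ℝ)..t, F s (z (φ k) (s - 1 / ((φ k : ℝ) + 1))))
      atTop (𝓝 (x₀ + ∫ s in (0 : ℝ)..t, F s (x s))) := by
    refine tendsto_const_nhds.add
      (intervalIntegral.tendsto_integral_filter_of_dominated_convergence (fun _ => K) ?_ ?_ ?_ ?_)
    · exact Eventually.of_forall fun k =>
        (hFm _ ((hcont (hz _)).comp (continuous_id.sub continuous_const))).restrict
    · exact Eventually.of_forall fun k => Eventually.of_forall fun s _ => hK _ _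
    · exact intervalIntegrable_const
    · exact Eventually.of_forall fun s _ => ((hFc s).tendsto _).comp (hdelay s)
  refine tendsto_nhds_unique (hx t) (hlim.congr' ?_)
  filter_upwards [hφ.tendsto_atTop.eventually_ge_atTop ⌈t⌉₊] with k hk
  exact (hzeq (φ k) t ⟨ht, (Nat.le_ceil t).trans (by exact_mod_cast hk)⟩).symm

end Caratheodory

/-! ### Second-order interpolation error on a simplex -/

/-- Second-order Taylor estimate on a convex set, with a bound on the Hessian in the direction of
the increment only. Derivatives are taken within the set, up to its boundary. -/
theorem Convex.abs_sub_sub_fderivWithin_le {E : Type*} [NormedAddCommGroup E] [NormedSpace ℝ E]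
    {s : Set E} (hs : Convex ℝ s) (hu : UniqueDiffOn ℝ s) {φ : E → ℝ} (hφ : ContDiffOn ℝ 2 φ s)
    {z v : E} (hz : z ∈ s) (hzv : z + v ∈ s) {C : ℝ}
    (hC : ∀ ξ ∈ s, |fderivWithin ℝ (fderivWithin ℝ φ s) s ξ v v| ≤ C) :
    |φ (z + v) - φ z - fderivWithin ℝ φ s z v| ≤ C / 2 := by
  have hseg : ∀ t ∈ Icc (0 : ℝ) 1, z + t • v ∈ s := fun t ht =>
    hs.add_smul_mem hz hzv ht
  have hγ : ∀ t, HasDerivWithinAt (fun t : ℝ => z + t • v) v (Icc 0 1) t := fun t => by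
    simpa using (((hasDerivAt_id t).smul_const v).const_add z).hasDerivWithinAt
  have hg : ∀ t ∈ Icc (0 : ℝ) 1, HasDerivWithinAt (fun t : ℝ => φ (z + t • v))
      (fderivWithin ℝ φ s (z + t • v) v) (Icc 0 1) t := fun t ht =>
    ((hφ.differentiableOn (by norm_num) _ (hseg t ht)).hasFDerivWithinAt).comp_hasDerivWithinAt t
      (hγ t) hseg
  have hφ' : ContDiffOn ℝ 1 (fderivWithin ℝ φ s) s := hφ.fderivWithin hu (by norm_num)
  have hg' : ∀ t ∈ Icc (0 : ℝ) 1, HasDerivWithinAt (fun t : ℝ => fderivWithin ℝ φ s (z + t • v) v)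
      (fderivWithin ℝ (fderivWithin ℝ φ s) s (z + t • v) v v) (Icc 0 1) t := fun t ht => by
    have hd := (hφ'.differentiableOn (by norm_num) _ (hseg t ht)).hasFDerivWithinAt
    have hd' := (ContinuousLinearMap.apply ℝ ℝ v).hasFDerivAt.comp_hasFDerivWithinAt _ hd
    exact hd'.comp_hasDerivWithinAt t (hγ t) hseg
  have h1 : ∀ t ∈ Icc (0 : ℝ) 1,
      ‖fderivWithin ℝ φ s (z + t • v) v - fderivWithin ℝ φ s z v‖ ≤ C * t := by
    intro t ht
    have := (convex_Icc (0 : ℝ) 1).norm_image_sub_le_of_norm_hasDerivWithin_le hg'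
      (fun t ht => hC _ (hseg t ht)) (left_mem_Icc.2 zero_le_one) ht
    simpa [abs_of_nonneg ht.1] using this
  have h2 : ∀ t ∈ Icc (0 : ℝ) 1, HasDerivWithinAt
      (fun t : ℝ => φ (z + t • v) - φ z - t * fderivWithin ℝ φ s z v)
      (fderivWithin ℝ φ s (z + t • v) v - fderivWithin ℝ φ s z v) (Icc 0 1) t := fun t ht => by
    have := ((hg t ht).sub_const (φ z)).sub
      ((hasDerivWithinAt_id t (Icc 0 1)).mul_const (fderivWithin ℝ φ s z v))
    rw [one_mul] at this
    exact this
  have h3 := image_norm_le_of_norm_deriv_right_le_deriv_boundary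
    (B := fun t => C * t ^ 2 / 2) (B' := fun t => C * t) (a := 0) (b := 1)
    (fun t ht => (h2 t ht).continuousWithinAt)
    (fun t ht => ((h2 t (Ico_subset_Icc_self ht)).mono_of_mem_nhdsWithin
      (Icc_mem_nhdsGE_of_mem ht)))
    (by simp) (fun t =>
      (((hasDerivAt_pow 2 t).const_mul C).div_const 2).congr_deriv (by norm_num; ring))
    (fun t ht => h1 t (Ico_subset_Icc_self ht)) (right_mem_Icc.2 zero_le_one)
  simpa using h3

/-- Points of the convex hull of a finite family are convex combinations of the whole family. -/
theorem exists_weights_of_mem_convexHull_range {E ι : Type*} [AddCommGroup E] [Module ℝ E]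
    [Fintype ι] {x : ι → E} {z : E} (hz : z ∈ convexHull ℝ (range x)) :
    ∃ w : ι → ℝ, (∀ j, 0 ≤ w j) ∧ ∑ j, w j = 1 ∧ ∑ j, w j • x j = z := by
  classical
  have h : range x = (Fintype.linearCombination ℝ x) '' range fun i : ι => Pi.single i (1 : ℝ) := by
    rw [← range_comp]
    congr 1
    ext1 i
    simp [Fintype.linearCombination_apply_single]
  rw [h, ← LinearMap.image_convexHull, convexHull_rangle_single_eq_stdSimplex] at hz
  obtain ⟨w, hw, rfl⟩ := hz
  exact ⟨w, hw.1, hw.2, by simp [Fintype.linearCombination_apply]⟩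

theorem vecNorm_nonneg (p : ℝ≥0∞) [Fact (1 ≤ p)] {n : ℕ} (v : Fin n → ℝ) : 0 ≤ vecNorm p v :=
  norm_nonneg _

theorem vecNorm_sum_smul_le (p : ℝ≥0∞) [Fact (1 ≤ p)] {n : ℕ} {ι : Type*} (s : Finset ι)
    {w : ι → ℝ} (hw : ∀ j ∈ s, 0 ≤ w j) (v : ι → Fin n → ℝ) :
    vecNorm p (∑ j ∈ s, w j • v j) ≤ ∑ j ∈ s, w j * vecNorm p (v j) := by
  unfold vecNorm
  rw [WithLp.toLp_sum]
  refine (norm_sum_le _ _).trans (Finset.sum_le_sum fun j hj => ?_)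
  rw [WithLp.toLp_smul, norm_smul, Real.norm_of_nonneg (hw j hj)]

theorem vecNorm_two_sq {n : ℕ} (v : Fin n → ℝ) : vecNorm 2 v ^ 2 = v ⬝ᵥ v := by
  have := EuclideanSpace.real_norm_sq_eq (WithLp.toLp 2 v : EuclideanSpace ℝ (Fin n))
  simpa [vecNorm, dotProduct, sq] using this

/-- For `p ≤ 2` the `p`-norm is at least the Euclidean norm. -/
theorem sum_sq_le_vecNorm_sq {p : ℝ≥0∞} (hp1 : 1 ≤ p) (hp2 : p ≤ 2) {n : ℕ} (v : Fin n → ℝ) :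
    ∑ k, v k ^ 2 ≤ vecNorm p v ^ 2 := by
  have : Fact (1 ≤ p) := ⟨hp1⟩
  have hptop : p ≠ ∞ := ne_top_of_le_ne_top (by simp) hp2
  have hpr1 : 1 ≤ p.toReal := by
    simpa using (ENNReal.toReal_le_toReal (by simp) hptop).2 hp1
  have hpr2 : p.toReal ≤ 2 := by
    simpa using (ENNReal.toReal_le_toReal hptop (by simp)).2 hp2
  set N := vecNorm p v with hN
  have hN0 : 0 ≤ N := vecNorm_nonneg p v
  have hle : ∀ k, |v k| ≤ N := fun k => by
    exact PiLp.norm_apply_le (WithLp.toLp p v : PiLp p fun _ : Fin n => ℝ) k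
  have hNp : N ^ p.toReal = ∑ k, |v k| ^ p.toReal := by
    rw [hN, vecNorm, PiLp.norm_eq_sum (by linarith),
      ← Real.rpow_mul (Finset.sum_nonneg fun _ _ => Real.rpow_nonneg (norm_nonneg _) _),
      one_div_mul_cancel (by linarith), Real.rpow_one]
    simp
  rcases hN0.eq_or_lt with h0 | h0
  · have : ∀ k, v k = 0 := fun k => abs_nonpos_iff.1 (h0 ▸ hle k)
    simp [this, sq_nonneg]
  have key : ∀ k, v k ^ 2 ≤ N ^ 2 * (|v k| ^ p.toReal / N ^ p.toReal) := by
    intro k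
    rcases (abs_nonneg (v k)).eq_or_lt with hk | hk
    · rw [abs_eq_zero.1 hk.symm, zero_pow two_ne_zero]; positivity
    have h1 := Real.rpow_le_rpow_of_exponent_ge (div_pos hk h0)
      ((div_le_one h0).2 (hle k)) hpr2
    rw [Real.rpow_two, div_pow, sq_abs, Real.div_rpow hk.le hN0, div_le_iff₀ (by positivity)] at h1
    linarith
  calc ∑ k, v k ^ 2 ≤ ∑ k, N ^ 2 * (|v k| ^ p.toReal / N ^ p.toReal) :=
        Finset.sum_le_sum fun k _ => key k
    _ = N ^ 2 := by
      rw [← Finset.mul_sum, ← Finset.sum_div, ← hNp, div_self (by positivity), mul_one]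

namespace Triangulation

variable {n : ℕ} (T : Triangulation n)

theorem vert_mem_simplex (i : Fin T.N) (j : Fin (n + 1)) : T.vert i j ∈ T.simplex i :=
  subset_convexHull ℝ _ (mem_range_self j)

theorem convex_simplex (i : Fin T.N) : Convex ℝ (T.simplex i) := convex_convexHull ℝ _

theorem isClosed_simplex (i : Fin T.N) : IsClosed (T.simplex i) :=
  (finite_range (T.vert i)).isClosed_convexHull ℝ

theorem isClosed_carrier : IsClosed T.carrier :=
  isClosed_iUnion_of_finite T.isClosed_simplex

theorem uniqueDiffOn_simplex (i : Fin T.N) : UniqueDiffOn ℝ (T.simplex i) := by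
  refine uniqueDiffOn_convex (T.convex_simplex i) ?_
  rw [simplex, interior_convexHull_nonempty_iff_affineSpan_eq_top,
    (T.affineIndependent i).affineSpan_eq_top_iff_card_eq_finrank_add_one]
  simp

/-- A function which is continuous on every simplex is continuous on their union. -/
theorem continuousOn_carrier {Y : Type*} [TopologicalSpace Y] {φ : (Fin n → ℝ) → Y}
    (h : ∀ i, ContinuousOn φ (T.simplex i)) : ContinuousOn φ T.carrier :=
  (locallyFinite_of_finite T.simplex).continuousOn_iUnion T.isClosed_simplex h

theorem errCoeff_of_vert_eq (p : ℝ≥0∞) [Fact (1 ≤ p)] {i : Fin T.N} {j : Fin (n + 1)}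
    (h : T.vert i j = T.vert i 0) : T.errCoeff p i j = 0 := by
  simp [errCoeff, vecNorm, h]

end Triangulation

theorem IsHessianBound.mul_card_nonneg {n : ℕ} {φ : (Fin n → ℝ) → ℝ} {s : Set (Fin n → ℝ)} {B : ℝ}
    (h : IsHessianBound φ s B) (hs : s.Nonempty) : 0 ≤ n * B := by
  rcases n.eq_zero_or_pos with rfl | hn
  · simp
  · obtain ⟨z, hz⟩ := hs
    exact mul_nonneg n.cast_nonneg ((abs_nonneg _).trans (h.2 z hz ⟨0, hn⟩ ⟨0, hn⟩))

/-- A matrix with entries of absolute value at most `B` has a quadratic form of at most `n B` times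
the square of the Euclidean norm, by the Cauchy–Schwarz inequality. -/
theorem IsHessianBound.abs_fderivWithin_le {n : ℕ} {φ : (Fin n → ℝ) → ℝ} {s : Set (Fin n → ℝ)}
    {B : ℝ} (h : IsHessianBound φ s B) (hu : UniqueDiffOn ℝ s) {p : ℝ≥0∞} (hp1 : 1 ≤ p)
    (hp2 : p ≤ 2) (v : Fin n → ℝ) {ξ : Fin n → ℝ} (hξ : ξ ∈ s) :
    |fderivWithin ℝ (fderivWithin ℝ φ s) s ξ v v| ≤ n * B * vecNorm p v ^ 2 := by
  set M := fderivWithin ℝ (fderivWithin ℝ φ s) s ξ with hM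
  have hent : ∀ q r : Fin n, |M (Pi.single q 1) (Pi.single r 1)| ≤ B := by
    intro q r
    have := h.2 ξ hξ q r
    rw [iteratedFDerivWithin_two_apply φ hu hξ] at this
    simpa using this
  have hexp : M v v = ∑ q, ∑ r, v q * v r * M (Pi.single q 1) (Pi.single r 1) := by
    conv_lhs => rw [pi_eq_sum_univ' v]
    simp only [map_sum, map_smul, sum_apply, smul_apply,
      smul_eq_mul, Finset.mul_sum]
    rw [Finset.sum_comm]
    refine Finset.sum_congr rfl fun q _ => Finset.sum_congr rfl fun r _ => by ring
  have hsq : (∑ q, |v q|) ^ 2 ≤ n * vecNorm p v ^ 2 := by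
    have h1 := sq_sum_le_card_mul_sum_sq (s := Finset.univ) (f := fun q => |v q|)
    simp only [sq_abs, Finset.card_univ, Fintype.card_fin] at h1
    exact h1.trans (mul_le_mul_of_nonneg_left (sum_sq_le_vecNorm_sq hp1 hp2 v) n.cast_nonneg)
  rcases n.eq_zero_or_pos with rfl | hn
  · simp [hexp]
  have hB : 0 ≤ B := (abs_nonneg _).trans (hent ⟨0, hn⟩ ⟨0, hn⟩)
  calc |M v v| ≤ ∑ q, ∑ r, |v q| * |v r| * B := by
        rw [hexp]
        refine (Finset.abs_sum_le_sum_abs _ _).trans (Finset.sum_le_sum fun q _ => ?_)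
        refine (Finset.abs_sum_le_sum_abs _ _).trans (Finset.sum_le_sum fun r _ => ?_)
        rw [abs_mul, abs_mul]
        exact mul_le_mul_of_nonneg_left (hent q r) (by positivity)
    _ = (∑ q, |v q|) ^ 2 * B := by
        rw [sq, Finset.sum_mul_sum, Finset.sum_mul]
        exact Finset.sum_congr rfl fun q _ => by rw [Finset.sum_mul]
    _ ≤ n * vecNorm p v ^ 2 * B := mul_le_mul_of_nonneg_right hsq hB
    _ = n * B * vecNorm p v ^ 2 := by ring

/-- The error of affine interpolation on a simplex. Both the interpolated point and the vertices
are compared with the Taylor polynomial at the vertex number `0`. -/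
theorem IsHessianBound.abs_sub_sum_le {n : ℕ} {T : Triangulation n} {i : Fin T.N}
    {φ : (Fin n → ℝ) → ℝ} {B : ℝ} (h : IsHessianBound φ (T.simplex i) B) {p : ℝ≥0∞}
    (hp1 : 1 ≤ p) (hp2 : p ≤ 2) {w : Fin (n + 1) → ℝ} (hw0 : ∀ j, 0 ≤ w j) (hw1 : ∑ j, w j = 1) :
    |φ (∑ j, w j • T.vert i j) - ∑ j, w j * φ (T.vert i j)|
      ≤ B * ∑ j, w j * T.errCoeff p i j := by
  have : Fact (1 ≤ p) := ⟨hp1⟩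
  have hu := T.uniqueDiffOn_simplex i
  set z := T.vert i 0 with hz
  have hzs : z ∈ T.simplex i := T.vert_mem_simplex i 0
  set D := fderivWithin ℝ φ (T.simplex i) z with hD
  have taylor : ∀ v, z + v ∈ T.simplex i →
      |φ (z + v) - φ z - D v| ≤ n * B * vecNorm p v ^ 2 / 2 := fun v hv =>
    (T.convex_simplex i).abs_sub_sub_fderivWithin_le hu h.1 hzs hv fun ξ hξ =>
      h.abs_fderivWithin_le hu hp1 hp2 v hξ
  set d : Fin (n + 1) → Fin n → ℝ := fun j => T.vert i j - z with hd
  have hvert : ∀ j, T.vert i j = z + d j := fun j => by simp [hd]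
  set v := ∑ j, w j • d j with hv
  have hx : ∑ j, w j • T.vert i j = z + v := by
    simp only [hvert, smul_add, Finset.sum_add_distrib, ← Finset.sum_smul, hw1, one_smul, hv]
  have hxs : z + v ∈ T.simplex i := by
    rw [← hx]
    exact (T.convex_simplex i).sum_mem (fun j _ => hw0 j) hw1 fun j _ => T.vert_mem_simplex i j
  set a : Fin (n + 1) → ℝ := fun j => vecNorm p (d j) with ha
  have ha0 : ∀ j, 0 ≤ a j := fun j => vecNorm_nonneg p _
  set m := ⨆ k : Fin n, vecNorm p (T.vert i k.succ - T.vert i 0) with hm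
  have ham : ∀ j, a j ≤ m := by
    intro j
    refine Fin.cases ?_ (fun k => ?_) j
    · have : a 0 = 0 := by simp [ha, hd, hz, vecNorm]
      rw [this]
      exact Real.iSup_nonneg fun k => vecNorm_nonneg p _
    · exact le_ciSup (f := fun k : Fin n => vecNorm p (T.vert i k.succ - T.vert i 0))
        (finite_range _).bddAbove k
  have hva : vecNorm p v ≤ ∑ j, w j * a j := vecNorm_sum_smul_le p _ (fun j _ => hw0 j) d
  have hvm : vecNorm p v ≤ m := hva.trans <| by
    calc ∑ j, w j * a j ≤ ∑ j, w j * m :=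
          Finset.sum_le_sum fun j _ => mul_le_mul_of_nonneg_left (ham j) (hw0 j)
      _ = m := by rw [← Finset.sum_mul, hw1, one_mul]
  have hva2 : vecNorm p v ^ 2 ≤ m * ∑ j, w j * a j := by
    rw [sq]
    exact mul_le_mul hvm hva (vecNorm_nonneg p v) ((vecNorm_nonneg p v).trans hvm)
  have hnB : 0 ≤ n * B := h.mul_card_nonneg ⟨z, hzs⟩
  have hsplit : φ (∑ j, w j • T.vert i j) - ∑ j, w j * φ (T.vert i j) =
      (φ (z + v) - φ z - D v) - ∑ j, w j * (φ (z + d j) - φ z - D (d j)) := by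
    have h1 : D v = ∑ j, w j * D (d j) := by simp [hv]
    have h2 : ∑ j, w j * φ z = φ z := by rw [← Finset.sum_mul, hw1, one_mul]
    simp only [mul_sub, Finset.sum_sub_distrib, h2, hx, h1, ← hvert]
    ring
  have hsum : |∑ j, w j * (φ (z + d j) - φ z - D (d j))| ≤
      ∑ j, w j * (n * B * a j ^ 2 / 2) := by
    refine (Finset.abs_sum_le_sum_abs _ _).trans (Finset.sum_le_sum fun j _ => ?_)
    rw [abs_mul, abs_of_nonneg (hw0 j)]
    exact mul_le_mul_of_nonneg_left
      (taylor (d j) (by rw [← hvert]; exact T.vert_mem_simplex i j)) (hw0 j)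
  have hrhs : B * ∑ j, w j * T.errCoeff p i j =
      n * B * (m * ∑ j, w j * a j) / 2 + ∑ j, w j * (n * B * a j ^ 2 / 2) := by
    simp only [Triangulation.errCoeff, ← hm, Finset.mul_sum, Finset.sum_div,
      ← Finset.sum_add_distrib]
    refine Finset.sum_congr rfl fun j _ => ?_
    simp only [ha, hd, hz]
    ring
  rw [hsplit, hrhs]
  have h3 := mul_le_mul_of_nonneg_left hva2 hnB
  have h4 := taylor v hxs
  have h5 := abs_sub (φ (z + v) - φ z - D v) (∑ j, w j * (φ (z + d j) - φ z - D (d j)))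
  linarith

/-! ### Decrease of the storage and barrier functions along the vector field -/

/-- The linear functional with gradient `g`. -/
noncomputable def gradCLM {n : ℕ} (g : Fin n → ℝ) : (Fin n → ℝ) →L[ℝ] ℝ :=
  LinearMap.toContinuousLinearMap (dotProductBilin ℝ ℝ g)

@[simp] theorem gradCLM_apply {n : ℕ} (g v : Fin n → ℝ) : gradCLM g v = g ⬝ᵥ v := rfl

theorem abs_dotProduct_le_sum_mul_norm {n : ℕ} {g l v : Fin n → ℝ} (h : ∀ k, |g k| ≤ l k) :
    |g ⬝ᵥ v| ≤ (∑ k, l k) * ‖v‖ := by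
  rw [dotProduct, Finset.sum_mul]
  refine (Finset.abs_sum_le_sum_abs _ _).trans (Finset.sum_le_sum fun k _ => ?_)
  rw [abs_mul]
  exact mul_le_mul (h k) (norm_le_pi_norm v k) (abs_nonneg _) ((abs_nonneg _).trans (h k))

theorem norm_le_sum_of_abs_le {n : ℕ} {g l : Fin n → ℝ} (h : ∀ k, |g k| ≤ l k) :
    ‖g‖ ≤ ∑ k, l k := by
  have h0 : ∀ k, 0 ≤ l k := fun k => (abs_nonneg _).trans (h k)
  refine (pi_norm_le_iff_of_nonneg (Finset.sum_nonneg fun k _ => h0 k)).2 fun k => ?_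
  exact (h k).trans (Finset.single_le_sum (fun k _ => h0 k) (Finset.mem_univ k))

theorem norm_mulVec_le_matNormInf {k m : ℕ} (A : Matrix (Fin k) (Fin m) ℝ) (v : Fin m → ℝ) :
    ‖A *ᵥ v‖ ≤ matNormInf A * ‖v‖ :=
  (LinearMap.toContinuousLinearMap A.mulVecLin).le_opNorm v

theorem matNormInf_nonneg {k m : ℕ} (A : Matrix (Fin k) (Fin m) ℝ) : 0 ≤ matNormInf A :=
  norm_nonneg _

namespace Triangulation

variable {n : ℕ} {T : Triangulation n} {U : (Fin n → ℝ) → ℝ}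

theorem IsCPA.sub_eq (hU : T.IsCPA U) (i : Fin T.N) {z w : Fin n → ℝ} (hz : z ∈ T.simplex i)
    (hw : w ∈ T.simplex i) : U w - U z = gradCLM (T.grad U i) (w - z) := by
  rw [hU i z hz, hU i w hw, gradCLM_apply, dotProduct_sub, dotProduct_sub, dotProduct_sub]
  ring

theorem IsCPA.continuousOn (hU : T.IsCPA U) : ContinuousOn U T.carrier := by
  refine T.continuousOn_carrier fun i => ?_
  have : ContinuousOn (fun x => U (T.vert i 0) + gradCLM (T.grad U i) (x - T.vert i 0))
      (T.simplex i) := by fun_prop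
  exact this.congr (hU i)

theorem IsCPA.nonneg (hU : T.IsCPA U) (h0 : ∀ i j, 0 ≤ U (T.vert i j)) {z : Fin n → ℝ}
    (hz : z ∈ T.carrier) : 0 ≤ U z := by
  obtain ⟨i, hi⟩ := mem_iUnion.1 hz
  have hconv : Convex ℝ {x | 0 ≤ U (T.vert i 0) + gradCLM (T.grad U i) (x - T.vert i 0)} := by
    have hlin : IsLinearMap ℝ (gradCLM (T.grad U i)) := (gradCLM (T.grad U i)).toLinearMap.isLinear
    have heq : {x | 0 ≤ U (T.vert i 0) + gradCLM (T.grad U i) (x - T.vert i 0)} =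
        {x | gradCLM (T.grad U i) (T.vert i 0) - U (T.vert i 0) ≤ gradCLM (T.grad U i) x} := by
      ext x
      rw [mem_ofPred_eq, mem_ofPred_eq, map_sub]
      constructor <;> intro h <;> linarith
    rw [heq]
    exact convex_halfSpace_ge hlin _
  have hsub : T.simplex i ⊆ {x | 0 ≤ U (T.vert i 0) + gradCLM (T.grad U i) (x - T.vert i 0)} := by
    refine convexHull_min ?_ hconv
    rintro _ ⟨j, rfl⟩
    have := h0 i j
    rwa [hU i _ (T.vert_mem_simplex i j)] at this
  rw [hU i z hi]
  exact hsub hi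

end Triangulation

namespace ControlAffineSystem

variable {n m q : ℕ} {S : ControlAffineSystem n m q} {T : Triangulation n} {p : ℝ≥0∞}

/-- The interpolation error of the vector field in a direction with components at most `l`. -/
theorem dotProduct_f_le {i : Fin T.N} {B : ℝ}
    (hf : ∀ k, IsHessianBound (fun x => S.f x k) (T.simplex i) B)
    (hp1 : 1 ≤ p) (hp2 : p ≤ 2) {w : Fin (n + 1) → ℝ} (hw0 : ∀ j, 0 ≤ w j) (hw1 : ∑ j, w j = 1)
    {g l : Fin n → ℝ} (hg : ∀ k, |g k| ≤ l k) :
    S.f (∑ j, w j • T.vert i j) ⬝ᵥ g ≤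
      ∑ j, w j * (S.f (T.vert i j) ⬝ᵥ g + (∑ k, l k) * (B * T.errCoeff p i j)) := by
  have hterm : ∀ k, S.f (∑ j, w j • T.vert i j) k * g k ≤
      (∑ j, w j * S.f (T.vert i j) k) * g k + l k * (B * ∑ j, w j * T.errCoeff p i j) := by
    intro k
    have h1 := (hf k).abs_sub_sum_le hp1 hp2 hw0 hw1
    have h2 := (le_abs_self _).trans (abs_mul (S.f (∑ j, w j • T.vert i j) k -
      ∑ j, w j * S.f (T.vert i j) k) (g k)).le
    have h3 := mul_le_mul h1 (hg k) (abs_nonneg _) ((abs_nonneg _).trans h1)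
    linarith
  have hswap : ∑ k, (∑ j, w j * S.f (T.vert i j) k) * g k =
      ∑ j, w j * (S.f (T.vert i j) ⬝ᵥ g) := by
    simp only [dotProduct, Finset.sum_mul, Finset.mul_sum]
    rw [Finset.sum_comm]
    exact Finset.sum_congr rfl fun j _ => Finset.sum_congr rfl fun k _ => by ring
  calc S.f (∑ j, w j • T.vert i j) ⬝ᵥ g ≤ ∑ k, ((∑ j, w j * S.f (T.vert i j) k) * g k +
        l k * (B * ∑ j, w j * T.errCoeff p i j)) := Finset.sum_le_sum fun k _ => hterm k
    _ = ∑ j, w j * (S.f (T.vert i j) ⬝ᵥ g) +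
        (∑ k, l k) * (B * ∑ j, w j * T.errCoeff p i j) := by
      rw [Finset.sum_add_distrib, hswap, ← Finset.sum_mul]
    _ = _ := by
      rw [Finset.mul_sum, Finset.mul_sum, ← Finset.sum_add_distrib]
      exact Finset.sum_congr rfl fun j _ => by ring

/-- The control term of the dissipation inequality, estimated by Young's inequality. -/
theorem dotProduct_mulVec_le {k : ℕ} (A : Matrix (Fin k) (Fin m) ℝ) {g l : Fin k → ℝ}
    (hg : ∀ j, |g j| ≤ l j) {γ : ℝ} (hγ : 0 < γ) (u : Fin m → ℝ) :
    g ⬝ᵥ (A *ᵥ u) ≤ 1 / (2 * γ) * matNormInf (A * Aᵀ) * (∑ j, l j) ^ 2 + γ / 2 * (u ⬝ᵥ u) := by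
  have hl0 : 0 ≤ ∑ j, l j := Finset.sum_nonneg fun j _ => (abs_nonneg _).trans (hg j)
  set a := g ᵥ* A with ha
  have h1 : g ⬝ᵥ (A *ᵥ u) ≤ 1 / (2 * γ) * (a ⬝ᵥ a) + γ / 2 * (u ⬝ᵥ u) := by
    rw [Matrix.dotProduct_mulVec, ← ha, dotProduct, dotProduct, dotProduct, Finset.mul_sum,
      Finset.mul_sum, ← Finset.sum_add_distrib]
    refine Finset.sum_le_sum fun r _ => ?_
    have h : 1 / (2 * γ) * (a r * a r) + γ / 2 * (u r * u r) - a r * u r =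
        1 / (2 * γ) * (a r - γ * u r) ^ 2 := by field_simp; ring
    have h' : 0 ≤ 1 / (2 * γ) * (a r - γ * u r) ^ 2 := by positivity
    linarith
  have h2 : a ⬝ᵥ a = g ⬝ᵥ ((A * Aᵀ) *ᵥ g) := by
    rw [← Matrix.mulVec_mulVec, Matrix.mulVec_transpose, Matrix.dotProduct_mulVec]
  have h3 : a ⬝ᵥ a ≤ matNormInf (A * Aᵀ) * (∑ j, l j) ^ 2 := by
    rw [h2]
    calc g ⬝ᵥ ((A * Aᵀ) *ᵥ g) ≤ (∑ j, l j) * ‖(A * Aᵀ) *ᵥ g‖ :=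
          (le_abs_self _).trans (abs_dotProduct_le_sum_mul_norm hg)
      _ ≤ (∑ j, l j) * (matNormInf (A * Aᵀ) * ∑ j, l j) := by
          refine mul_le_mul_of_nonneg_left ((norm_mulVec_le_matNormInf _ _).trans ?_) hl0
          exact mul_le_mul_of_nonneg_left (norm_le_sum_of_abs_le hg) (matNormInf_nonneg _)
      _ = matNormInf (A * Aᵀ) * (∑ j, l j) ^ 2 := by ring
  have h4 := mul_le_mul_of_nonneg_left h3 (show 0 ≤ 1 / (2 * γ) by positivity)
  linarith

/-- The Hamilton–Jacobi inequality at the vertices. It is an assumption at the vertices other than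
the origin, and at the origin all terms vanish, the error coefficient because the origin is the base
vertex of its simplex. -/
theorem StorageConditions.hjTerm_nonpos {V : (Fin n → ℝ) → ℝ} {l : Fin T.N → Fin n → ℝ}
    {β βh βg : Fin T.N → ℝ} {γ b₁ : ℝ} (hV : S.StorageConditions T p V l β βh βg γ b₁)
    (hp1 : 1 ≤ p) (hb₁ : 0 < b₁) (hf0 : S.f 0 = 0) (hh0 : S.h 0 = 0) (hg0 : S.gBar 0 = 0)
    (hT0 : T.BasedAtOrigin) (i : Fin T.N) (j : Fin (n + 1)) :
    S.hjTerm T p V l β βh βg γ i j ≤ 0 := by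
  by_cases hj : T.vert i j = 0
  · have : Fact (1 ≤ p) := ⟨hp1⟩
    have h0 : T.vert i 0 = 0 := hT0 i (hj ▸ T.vert_mem_simplex i j)
    have hc : T.errCoeff p i j = 0 := T.errCoeff_of_vert_eq p (hj.trans h0.symm)
    simp [hjTerm, hc, hj, hf0, hh0, hg0, vecNorm]
  · linarith [hV.hj_le i j hj]

/-- The dissipation inequality. -/
theorem StorageConditions.dotProduct_le {V : (Fin n → ℝ) → ℝ} {l : Fin T.N → Fin n → ℝ}
    {β βh βg : Fin T.N → ℝ} {γ b₁ : ℝ} (hV : S.StorageConditions T p V l β βh βg γ b₁)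
    (hp1 : 1 ≤ p) (hp2 : p ≤ 2) (hb₁ : 0 < b₁) (hf0 : S.f 0 = 0) (hh0 : S.h 0 = 0)
    (hg0 : S.gBar 0 = 0) (hT0 : T.BasedAtOrigin) {i : Fin T.N} {x : Fin n → ℝ}
    (hx : x ∈ T.simplex i) (u : Fin m → ℝ) :
    T.grad V i ⬝ᵥ (S.f x + S.G x *ᵥ u) ≤ γ / 2 * (u ⬝ᵥ u) - 1 / 2 * (S.h x ⬝ᵥ S.h x) := by
  obtain ⟨w, hw0, hw1, rfl⟩ := exists_weights_of_mem_convexHull_range hx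
  set x := ∑ j, w j • T.vert i j
  have hγ := hV.gamma_pos
  set L := ∑ k, l i k with hL
  set κ := 1 / (2 * γ) with hκ
  have hκ0 : 0 ≤ κ := by positivity
  have e1 := dotProduct_f_le (hV.f_bound i) hp1 hp2 hw0 hw1 (hV.grad_le i)
  have e2 := (le_abs_self _).trans ((hV.h_bound i).abs_sub_sum_le hp1 hp2 hw0 hw1)
  have e3 := (le_abs_self _).trans ((hV.g_bound i).abs_sub_sum_le hp1 hp2 hw0 hw1)
  have e4 := dotProduct_mulVec_le (S.G x) (hV.grad_le i) hγ u
  have e5 : ∑ j, w j * S.hjTerm T p V l β βh βg γ i j ≤ 0 :=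
    Finset.sum_nonpos fun j _ => mul_nonpos_of_nonneg_of_nonpos (hw0 j)
      (hV.hjTerm_nonpos hp1 hb₁ hf0 hh0 hg0 hT0 i j)
  have e6 : ∑ j, w j * S.hjTerm T p V l β βh βg γ i j =
      ∑ j, w j * (S.f (T.vert i j) ⬝ᵥ T.grad V i + L * (β i * T.errCoeff p i j))
      + 1 / 2 * (∑ j, w j * (S.h (T.vert i j) ⬝ᵥ S.h (T.vert i j))
        + βh i * ∑ j, w j * T.errCoeff p i j)
      + κ * L ^ 2 * (∑ j, w j * S.gBar (T.vert i j) + βg i * ∑ j, w j * T.errCoeff p i j) := by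
    simp only [Finset.mul_sum, ← Finset.sum_add_distrib]
    refine Finset.sum_congr rfl fun j _ => ?_
    rw [hjTerm, vecNorm_two_sq]
    ring
  have e7 := mul_le_mul_of_nonneg_left e3 (show 0 ≤ κ * L ^ 2 by positivity)
  have e8 : matNormInf (S.G x * (S.G x)ᵀ) = S.gBar x := rfl
  rw [e8] at e4
  rw [dotProduct_add, dotProduct_comm]
  linarith

/-- Outside `A₁`, the barrier function decreases at a uniform rate under admissible controls. -/
theorem BarrierConditions.dotProduct_le {A₁ : Set (Fin n → ℝ)} {W : (Fin n → ℝ) → ℝ}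
    {l : Fin T.N → Fin n → ℝ} {β gmax : Fin T.N → ℝ} {b₂ uMax : ℝ}
    (hW : S.BarrierConditions T p A₁ W l β gmax b₂ uMax) (hp1 : 1 ≤ p) (hp2 : p ≤ 2)
    {i : Fin T.N} (hi : ¬ T.simplex i ⊆ A₁) {x : Fin n → ℝ} (hx : x ∈ T.simplex i)
    {u : Fin m → ℝ} (hu : ‖u‖ ≤ uMax) :
    T.grad W i ⬝ᵥ (S.f x + S.G x *ᵥ u) ≤ -b₂ := by
  have hGx : matNormInf (S.G x) ≤ gmax i := (hW.gmax_isGreatest i).2 (mem_image_of_mem _ hx)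
  obtain ⟨w, hw0, hw1, rfl⟩ := exists_weights_of_mem_convexHull_range hx
  set x := ∑ j, w j • T.vert i j
  set L := ∑ k, l i k with hL
  have hL0 : 0 ≤ L := Finset.sum_nonneg fun k _ => (abs_nonneg _).trans (hW.grad_le i k)
  have e1 := dotProduct_f_le (hW.f_bound i) hp1 hp2 hw0 hw1 (hW.grad_le i)
  have e2 : T.grad W i ⬝ᵥ (S.G x *ᵥ u) ≤ L * (gmax i * uMax) := by
    refine ((le_abs_self _).trans (abs_dotProduct_le_sum_mul_norm (hW.grad_le i))).trans ?_
    refine mul_le_mul_of_nonneg_left ((norm_mulVec_le_matNormInf _ _).trans ?_) hL0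
    exact mul_le_mul hGx hu (norm_nonneg _) ((matNormInf_nonneg _).trans hGx)
  have e3 : ∑ j, w j * (S.f (T.vert i j) ⬝ᵥ T.grad W i
      + L * (β i * T.errCoeff p i j + gmax i * uMax)) ≤ ∑ j, w j * (-b₂) :=
    Finset.sum_le_sum fun j _ => mul_le_mul_of_nonneg_left (hW.decrease i hi j) (hw0 j)
  have e4 : ∑ j, w j * (S.f (T.vert i j) ⬝ᵥ T.grad W i
      + L * (β i * T.errCoeff p i j + gmax i * uMax)) =
      ∑ j, w j * (S.f (T.vert i j) ⬝ᵥ T.grad W i + L * (β i * T.errCoeff p i j))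
      + (∑ j, w j) * (L * (gmax i * uMax)) := by
    rw [Finset.sum_mul, ← Finset.sum_add_distrib]
    exact Finset.sum_congr rfl fun j _ => by ring
  rw [← Finset.sum_mul, hw1, one_mul] at e3
  rw [hw1, one_mul] at e4
  rw [dotProduct_add, dotProduct_comm]
  linarith

end ControlAffineSystem

/-! ### Invariance of the sublevel set -/

/-- The increment of a CPA function along a curve meeting only simplexes with the property `P`, on
which the derivative along the curve is at most `ρ`. -/
theorem Triangulation.IsCPA.sub_le_mul {n : ℕ} {T : Triangulation n} {U : (Fin n → ℝ) → ℝ}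
    (hU : T.IsCPA U) (P : Fin T.N → Prop) {τ : ℝ} {x v : ℝ → Fin n → ℝ}
    (hv : IntervalIntegrable v volume 0 τ)
    (hx : ∀ t ∈ Icc 0 τ, x t = x 0 + ∫ s in (0 : ℝ)..t, v s) {a b : ℝ} (ha : 0 ≤ a) (hab : a ≤ b)
    (hb : b ≤ τ) (hmem : ∀ t ∈ Icc a b, ∃ i, P i ∧ x t ∈ T.simplex i) {ρ : ℝ}
    (hrate : ∀ s ∈ Ioo a b, ∀ i, P i → x s ∈ T.simplex i → T.grad U i ⬝ᵥ v s ≤ ρ) :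
    U (x b) - U (x a) ≤ ρ * (b - a) := by
  have h0τ : 0 ≤ τ := ha.trans (hab.trans hb)
  have hsub : ∀ {s t}, s ∈ Icc 0 τ → t ∈ Icc 0 τ → IntervalIntegrable v volume s t := fun hs ht =>
    hv.mono_set (by rw [uIcc_of_le h0τ]; exact ordConnected_Icc.uIcc_subset hs ht)
  have h0 : (0 : ℝ) ∈ Icc 0 τ := left_mem_Icc.2 h0τ
  have haI : a ∈ Icc 0 τ := ⟨ha, hab.trans hb⟩
  have hbI : b ∈ Icc 0 τ := ⟨ha.trans hab, hb⟩
  have key := image_sub_le_integral (ι := {i // P i}) (σ := fun i => T.simplex i)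
    (fun i => T.isClosed_simplex i) (U := U) (p := fun i => gradCLM (T.grad U i))
    (fun i z hz w hw => hU.sub_eq i hz hw) hab (hsub haI hbI) (x := x)
    (fun t ht => by
      have htI : t ∈ Icc 0 τ := ⟨ha.trans ht.1, ht.2.trans hb⟩
      rw [hx t htI, hx a haI, add_assoc,
        intervalIntegral.integral_add_adjacent_intervals (hsub h0 haI) (hsub haI htI)])
    (fun t ht => by
      obtain ⟨i, hi, hi'⟩ := hmem t ht
      exact ⟨⟨i, hi⟩, hi'⟩) (r := fun _ => ρ) intervalIntegrable_const
    (Eventually.of_forall fun s hs i hi => hrate s hs i i.2 hi)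
  rwa [intervalIntegral.integral_const, smul_eq_mul, mul_comm] at key

/-- A sublevel set `A` of a CPA function `W` is invariant along a curve with velocity `v` if `W`
decreases strictly while the curve is in `A` and in a simplex not contained in `A₁`, and if, around
a time at which the curve is at a boundary point of `A` belonging to `A₁`, it does not increase in
such simplexes. A boundary point of `A` outside `A₁` cannot be reached from within `A`, as `W` would
decrease strictly to its maximal value `c`. After a boundary point in `A₁` the curve remains in
the domain of `W`, and `W` does not increase from the value `c` while the curve is outside `A`. -/
theorem Triangulation.IsCPA.mem_sublevel {n : ℕ} {T : Triangulation n} {W : (Fin n → ℝ) → ℝ}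
    (hW : T.IsCPA W) {A A₁ : Set (Fin n → ℝ)} {c : ℝ} (hA : A = {x ∈ T.carrier | W x ≤ c})
    (hAc : ∀ x ∈ frontier A, W x = c) (hA₁ : IsClosed A₁) (hA₁A : A₁ ⊆ A)
    (hA₁T : A₁ ⊆ interior T.carrier) {b : ℝ} (hb : 0 < b) {τ : ℝ} {x v : ℝ → Fin n → ℝ}
    (hv : IntervalIntegrable v volume 0 τ)
    (hx : ∀ t ∈ Icc 0 τ, x t = x 0 + ∫ s in (0 : ℝ)..t, v s) (hx0 : x 0 ∈ interior A)
    (hdec : ∀ s ∈ Icc 0 τ, x s ∈ A → ∀ i, ¬ T.simplex i ⊆ A₁ → x s ∈ T.simplex i →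
      T.grad W i ⬝ᵥ v s ≤ -b)
    (hbd : ∀ t ∈ Icc 0 τ, x t ∈ A₁ → x t ∈ frontier A → ∀ᶠ s in 𝓝[Icc 0 τ] t,
      ∀ i, ¬ T.simplex i ⊆ A₁ → x s ∈ T.simplex i → T.grad W i ⬝ᵥ v s ≤ 0) :
    ∀ t ∈ Icc 0 τ, x t ∈ A := by
  intro t₀ ht₀
  have h0τ : 0 ≤ τ := ht₀.1.trans ht₀.2
  have hxc : ContinuousOn x (Icc 0 τ) := by
    have h1 := (intervalIntegral.continuousOn_primitive_interval'
      (a := 0) hv left_mem_uIcc).const_add (x 0)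
    rw [uIcc_of_le h0τ] at h1
    exact h1.congr hx
  have hAcl : IsClosed A := by
    have := T.isClosed_carrier.isClosed_le hW.continuousOn (continuousOn_const (c := c))
    rw [hA]
    exact this
  have hAT : A ⊆ T.carrier := by rw [hA]; exact fun z hz => hz.1
  have hAle : ∀ z ∈ A, W z ≤ c := by rw [hA]; exact fun z hz => hz.2
  have hAgt : ∀ z ∈ T.carrier, z ∉ A → c < W z := by
    intro z hz hzA
    rw [hA] at hzA
    exact not_le.1 fun h => hzA ⟨hz, h⟩
  have hout : ∀ z ∈ T.carrier, z ∉ A₁ → ∃ i, ¬ T.simplex i ⊆ A₁ ∧ z ∈ T.simplex i := by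
    intro z hz hzA
    obtain ⟨i, hi⟩ := mem_iUnion.1 hz
    exact ⟨i, fun h => hzA (h hi), hi⟩
  have key : Icc 0 τ ⊆ {t | ∀ r ∈ Icc 0 t, x r ∈ A} := by
    refine IsClosed.Icc_subset_of_forall_exists_gt ?_ ?_ ?_
    · refine isClosed_of_closure_subset fun t ht => ?_
      have htI : t ∈ Icc 0 τ := isClosed_Icc.closure_subset (closure_mono inter_subset_right ht)
      refine ⟨fun r hr => ?_, htI⟩
      rcases hr.2.lt_or_eq with hlt | rfl
      · obtain ⟨s, hs, hs'⟩ := mem_closure_iff.1 ht (Ioi r) isOpen_Ioi hlt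
        exact hs'.1 r ⟨hr.1, le_of_lt hs⟩
      · have hmaps : MapsTo x ({t | ∀ r ∈ Icc 0 t, x r ∈ A} ∩ Icc 0 τ) A :=
          fun s hs => hs.1 s ⟨hs.2.1, le_rfl⟩
        have := ((hxc r htI).mono inter_subset_right).mem_closure ht hmaps
        rwa [hAcl.closure_eq] at this
    · intro r hr
      have : r = 0 := le_antisymm hr.2 hr.1
      exact this ▸ interior_subset hx0
    · rintro t ⟨hts, htI⟩ y hy
      have htI' : t ∈ Icc 0 τ := Ico_subset_Icc_self htI
      have hxtA : x t ∈ A := hts t ⟨htI.1, le_rfl⟩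
      suffices hev : ∀ᶠ s in 𝓝[>] t, ∀ r ∈ Icc t s, x r ∈ A by
        obtain ⟨s, hs, hs'⟩ := (hev.and (Ioc_mem_nhdsGT hy)).exists
        refine ⟨s, fun r hr => ?_, hs'⟩
        rcases le_total r t with h | h
        · exact hts r ⟨hr.1, h⟩
        · exact hs r ⟨h, hr.2⟩
      have hle : 𝓝[≥] t ≤ 𝓝[Icc 0 τ] t := by
        rw [← nhdsWithin_Icc_eq_nhdsGE htI.2]
        exact nhdsWithin_mono _ (Icc_subset_Icc_left htI.1)
      -- A property of times holding right after `t` holds on an interval `[t, d)`.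
      have hinterval : ∀ {Q : ℝ → Prop}, (∀ᶠ s in 𝓝[≥] t, Q s) →
          ∀ᶠ s in 𝓝[>] t, ∀ r ∈ Icc t s, Q r := by
        intro Q hQ
        obtain ⟨d, hd, hd'⟩ := (mem_nhdsGE_iff_exists_Ico_subset).1 hQ
        filter_upwards [Ioo_mem_nhdsGT hd] with s hs r hr
        exact hd' ⟨hr.1, hr.2.trans_lt hs.2⟩
      by_cases hint : x t ∈ interior A
      · exact hinterval (mem_of_superset (hle ((hxc t htI') (isOpen_interior.mem_nhds hint)))
          fun s hs => show x s ∈ A from interior_subset hs)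
      have hfr : x t ∈ frontier A := ⟨subset_closure hxtA, hint⟩
      have htpos : 0 < t := htI.1.lt_of_ne fun h => hint (h ▸ hx0)
      by_cases htA₁ : x t ∈ A₁
      · have hdom : ∀ᶠ s in 𝓝[≥] t, x s ∈ T.carrier :=
          mem_of_superset (hle ((hxc t htI') (isOpen_interior.mem_nhds (hA₁T htA₁))))
            fun s hs => show x s ∈ T.carrier from interior_subset hs
        have hIcc : ∀ᶠ s in 𝓝[≥] t, s ∈ Icc 0 τ := hle self_mem_nhdsWithin
        filter_upwards [hinterval (hdom.and (hle (hbd t htI' htA₁ hfr))), hinterval hIcc,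
          self_mem_nhdsWithin] with s hs hsI hst r hr
        by_contra hrA
        -- The last time before `r` at which the curve is in `A`.
        obtain ⟨e, ⟨heI, heA⟩, hmax⟩ : ∃ e, IsGreatest (Icc t r ∩ x ⁻¹' A) e := by
          have hrI : Icc t r ⊆ Icc 0 τ := fun z hz => hsI z ⟨hz.1, hz.2.trans hr.2⟩
          refine IsCompact.exists_isGreatest ?_ ⟨t, left_mem_Icc.2 hr.1, hxtA⟩
          exact isCompact_Icc.of_isClosed_subset
            ((hxc.mono hrI).preimage_isClosed_of_isClosed isClosed_Icc hAcl) inter_subset_left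
        have her : e < r := heI.2.lt_of_ne fun h => hrA (h ▸ heA)
        have hafter : ∀ z ∈ Ioc e r, x z ∉ A := fun z hz hzA =>
          not_lt.2 (hmax ⟨⟨heI.1.trans hz.1.le, hz.2⟩, hzA⟩) hz.1
        have hsub : Icc e r ⊆ Icc t s := Icc_subset_Icc heI.1 hr.2
        have hmem : ∀ z ∈ Icc e r, ∃ i, ¬ T.simplex i ⊆ A₁ ∧ x z ∈ T.simplex i := by
          have hcl : IsClosed (⋃ i : {i // ¬ T.simplex i ⊆ A₁}, T.simplex i) :=
            isClosed_iUnion_of_finite fun i => T.isClosed_simplex i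
          have hmaps : MapsTo x (Ioc e r) (⋃ i : {i // ¬ T.simplex i ⊆ A₁}, T.simplex i) := by
            intro z hz
            obtain ⟨i, hi, hzi⟩ := hout (x z) (hs z (hsub (Ioc_subset_Icc_self hz))).1
              fun h => hafter z hz (hA₁A h)
            exact mem_iUnion.2 ⟨⟨i, hi⟩, hzi⟩
          intro z hz
          have hzc : z ∈ closure (Ioc e r) := by rwa [closure_Ioc her.ne]
          have hcont : ContinuousWithinAt x (Ioc e r) z :=
            (hxc z (hsI z (hsub hz))).mono fun y hy => hsI y (hsub (Ioc_subset_Icc_self hy))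
          have := hcont.mem_closure hzc hmaps
          rw [hcl.closure_eq] at this
          obtain ⟨i, hi⟩ := mem_iUnion.1 this
          exact ⟨i, i.2, hi⟩
        have hdecr := hW.sub_le_mul (fun i => ¬ T.simplex i ⊆ A₁) hv hx (htI.1.trans heI.1)
          her.le (hsI r hr).2 hmem (ρ := 0)
          (fun z hz => (hs z (hsub (Ioo_subset_Icc_self hz))).2)
        have h1 := hAle _ heA
        have h2 := hAgt _ (hs r hr).1 hrA
        linarith
      · exfalso
        have hne : ∀ᶠ s in 𝓝[Icc 0 τ] t, x s ∉ A₁ :=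
          (hxc t htI') (hA₁.isOpen_compl.mem_nhds htA₁)
        have hle' : 𝓝[≤] t ≤ 𝓝[Icc 0 τ] t := by
          rw [← nhdsWithin_Icc_eq_nhdsLE htpos]
          exact nhdsWithin_mono _ (Icc_subset_Icc_right htI.2.le)
        obtain ⟨d, hd, hd'⟩ := (mem_nhdsLE_iff_exists_Ioc_subset).1 (hle' hne)
        obtain ⟨e, he, het⟩ := exists_between (max_lt hd htpos)
        have he0 : 0 < e := (le_max_right _ _).trans_lt he
        have hde : d < e := (le_max_left _ _).trans_lt he
        have hdecr := hW.sub_le_mul (fun i => ¬ T.simplex i ⊆ A₁) hv hx he0.le het.le htI.2.le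
          (fun z hz => hout _ (hAT (hts z ⟨he0.le.trans hz.1, hz.2⟩))
            (hd' ⟨hde.trans_le hz.1, hz.2⟩)) (ρ := -b)
          (fun z hz => hdec z ⟨he0.le.trans hz.1.le, hz.2.le.trans htI.2.le⟩
            (hts z ⟨he0.le.trans hz.1.le, hz.2.le⟩))
        have h1 := hAle _ (hts e ⟨he0.le, het.le⟩)
        have h2 := hAc _ hfr
        have h3 : 0 < b * (t - e) := mul_pos hb (sub_pos.2 het)
        linarith
  exact key ht₀ t₀ ⟨ht₀.1, le_rfl⟩

/-! ### Square integrable signals and bounded extensions -/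

theorem norm_toLp_two_sq {m : ℕ} (v : Fin m → ℝ) :
    ‖(WithLp.toLp 2 v : EuclideanSpace ℝ (Fin m))‖ ^ 2 = v ⬝ᵥ v :=
  vecNorm_two_sq v

theorem memLp_truncSignal_iff {m : ℕ} {τ : ℝ} {u : ℝ → Fin m → ℝ} :
    MemLp (truncSignal τ u) 2 volume ↔
      MemLp (fun t => (WithLp.toLp 2 (u t) : EuclideanSpace ℝ (Fin m))) 2
        (volume.restrict (Icc 0 τ)) :=
  memLp_indicator_iff_restrict measurableSet_Icc

theorem intervalIntegrable_dotProduct_self {m : ℕ} {τ : ℝ} (hτ : 0 ≤ τ) {u : ℝ → Fin m → ℝ}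
    (hu : MemLp (truncSignal τ u) 2 volume) :
    IntervalIntegrable (fun t => u t ⬝ᵥ u t) volume 0 τ := by
  rw [intervalIntegrable_iff_integrableOn_Icc_of_le hτ]
  have := (memLp_truncSignal_iff.1 hu).integrable_norm_pow two_ne_zero
  simp only [norm_toLp_two_sq] at this
  exact this

theorem truncL2Norm_sq {m : ℕ} {τ : ℝ} (hτ : 0 ≤ τ) {u : ℝ → Fin m → ℝ}
    (hu : MemLp (truncSignal τ u) 2 volume) :
    truncL2Norm τ u ^ 2 = ∫ t in (0 : ℝ)..τ, u t ⬝ᵥ u t := by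
  have h := memLp_truncSignal_iff.1 hu
  have h0 : 0 ≤ ∫ t in Icc 0 τ, ‖(WithLp.toLp 2 (u t) : EuclideanSpace ℝ (Fin m))‖ ^ 2 :=
    integral_nonneg fun _ => by positivity
  rw [truncL2Norm, truncSignal, eLpNorm_indicator_eq_eLpNorm_restrict measurableSet_Icc,
    h.eLpNorm_eq_integral_rpow_norm (by simp) (by simp)]
  simp only [ENNReal.toReal_ofNat, Real.rpow_two]
  rw [ENNReal.toReal_ofReal (by positivity), ← Real.rpow_natCast, ← Real.rpow_mul h0,
    intervalIntegral.integral_of_le hτ, ← integral_Icc_eq_integral_Ioc]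
  simp only [norm_toLp_two_sq]
  norm_num

theorem ContinuousOn.memLp_truncSignal {m : ℕ} {τ : ℝ} {y : ℝ → Fin m → ℝ}
    (hy : ContinuousOn y (Icc 0 τ)) : MemLp (truncSignal τ y) 2 volume := by
  rw [memLp_truncSignal_iff]
  have hc : ContinuousOn (fun t => (WithLp.toLp 2 (y t) : EuclideanSpace ℝ (Fin m))) (Icc 0 τ) :=
    (PiLp.continuous_toLp 2 _).comp_continuousOn hy
  obtain ⟨C, hC⟩ := isCompact_Icc.exists_bound_of_continuousOn hc
  exact MemLp.of_bound (hc.aestronglyMeasurable measurableSet_Icc) C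
    (ae_restrict_of_forall_mem measurableSet_Icc hC)

/-- A signal in `L²_e`, set to zero at negative times, is measurable. -/
theorem MemL2e.aemeasurable_indicator {m : ℕ} {u : ℝ → Fin m → ℝ} (hu : MemL2e u) :
    AEMeasurable ((Ici 0).indicator u) volume := by
  rw [aemeasurable_indicator_iff measurableSet_Ici]
  have hU : Ici (0 : ℝ) = ⋃ k : ℕ, Icc 0 (k : ℝ) := by
    ext t
    simp only [mem_Ici, mem_iUnion, mem_Icc]
    exact ⟨fun h => (exists_nat_ge t).imp fun k hk => ⟨h, hk⟩, fun ⟨_, h⟩ => h.1⟩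
  rw [hU, aemeasurable_iUnion_iff]
  intro k
  have := (memLp_truncSignal_iff.1 (hu k k.cast_nonneg)).aestronglyMeasurable
  exact ((PiLp.continuous_ofLp 2 fun _ : Fin m => ℝ).comp_aestronglyMeasurable this).aemeasurable

/-- Tietze's extension theorem for families of functions on a compact set, with a bound. -/
theorem IsCompact.exists_continuous_bounded_extension {X ι : Type*} [TopologicalSpace X]
    [NormalSpace X] [T2Space X] {K : Set X} (hK : IsCompact K) {φ : X → ι → ℝ}
    (hφ : ∀ i, ContinuousOn (fun x => φ x i) K) :
    ∃ (ψ : X → ι → ℝ) (C : ι → ℝ), Continuous ψ ∧ (∀ x i, |ψ x i| ≤ C i) ∧ EqOn ψ φ K := by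
  have : CompactSpace K := isCompact_iff_compactSpace.1 hK
  have hext : ∀ i, ∃ g : BoundedContinuousFunction X ℝ, ∀ x ∈ K, g x = φ x i := by
    intro i
    obtain ⟨g, -, hg⟩ := BoundedContinuousFunction.exists_norm_eq_domRestrict_eq_of_closed
      (BoundedContinuousFunction.mkOfCompact ⟨_, (hφ i).domRestrict⟩) hK.isClosed
    exact ⟨g, fun x hx => DFunLike.congr_fun hg (⟨x, hx⟩ : K)⟩
  choose g hg using hext
  exact ⟨fun x i => g i x, fun i => ‖g i‖, continuous_pi fun i => (g i).continuous,
    fun x i => (g i).norm_coe_le_norm x, fun x hx => funext fun i => hg i x hx⟩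

/-! ### Solutions of the system -/

namespace ControlAffineSystem

variable {n m q : ℕ} {S : ControlAffineSystem n m q}

theorem IsSolution.apply_zero {x₀ : Fin n → ℝ} {u : ℝ → Fin m → ℝ} {τ : ℝ} {x : ℝ → Fin n → ℝ}
    (h : S.IsSolution x₀ u τ x) (hτ : 0 ≤ τ) : x 0 = x₀ := by
  simpa using h.eq 0 (left_mem_Icc.2 hτ)

/-- A solution staying in the domain of the storage function satisfies the gain inequality:
integrate the dissipation inequality. -/
theorem StorageConditions.gain {T : Triangulation n} {p : ℝ≥0∞} {V : (Fin n → ℝ) → ℝ}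
    {l : Fin T.N → Fin n → ℝ} {β βh βg : Fin T.N → ℝ} {γ b₁ : ℝ}
    (hV : S.StorageConditions T p V l β βh βg γ b₁) (hp1 : 1 ≤ p) (hp2 : p ≤ 2) (hb₁ : 0 < b₁)
    (hf0 : S.f 0 = 0) (hh0 : S.h 0 = 0) (hg0 : S.gBar 0 = 0) (hT0 : T.BasedAtOrigin)
    (hh : ∀ k, T.PiecewiseC2 fun x => S.h x k) {x₀ : Fin n → ℝ} {u : ℝ → Fin m → ℝ} {τ : ℝ}
    (hτ : 0 ≤ τ) (hu : MemLp (truncSignal τ u) 2 volume) {x : ℝ → Fin n → ℝ}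
    (hx : S.IsSolution x₀ u τ x) (hmem : ∀ t ∈ Icc 0 τ, x t ∈ T.carrier) :
    MemLp (truncSignal τ fun t => S.h (x t)) 2 volume ∧
      truncL2Norm τ (fun t => S.h (x t)) ≤
        Real.sqrt γ * truncL2Norm τ u + Real.sqrt (2 * V x₀) := by
  have hx0 := hx.apply_zero hτ
  have hxc : ContinuousOn x (Icc 0 τ) := by
    have h1 := (intervalIntegral.continuousOn_primitive_interval'
      (a := 0) hx.integrable left_mem_uIcc).const_add x₀
    rw [uIcc_of_le hτ] at h1
    exact h1.congr hx.eq
  have hhc : ContinuousOn S.h T.carrier :=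
    T.continuousOn_carrier fun i => continuousOn_pi.2 fun k => (hh k i).continuousOn
  have hy : MemLp (truncSignal τ fun t => S.h (x t)) 2 volume :=
    (hhc.comp hxc hmem).memLp_truncSignal
  have hui := (intervalIntegrable_dotProduct_self hτ hu).const_mul (γ / 2)
  have hyi := (intervalIntegrable_dotProduct_self hτ hy).const_mul (1 / 2)
  have key := image_sub_le_integral T.isClosed_simplex (fun i _ hz _ hw => hV.cpa.sub_eq i hz hw)
    hτ hx.integrable (x := x) (fun t ht => by rw [hx0]; exact hx.eq t ht)
    (fun t ht => mem_iUnion.1 (hmem t ht)) (hui.sub hyi)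
    (Eventually.of_forall fun s _ i hi =>
      hV.dotProduct_le hp1 hp2 hb₁ hf0 hh0 hg0 hT0 hi (u s))
  rw [intervalIntegral.integral_sub hui hyi, intervalIntegral.integral_const_mul,
    intervalIntegral.integral_const_mul, ← truncL2Norm_sq hτ hu, ← truncL2Norm_sq hτ hy, hx0] at key
  have hVτ : 0 ≤ V (x τ) := hV.cpa.nonneg hV.nonneg (hmem τ (right_mem_Icc.2 hτ))
  have hV0 : 0 ≤ V x₀ := by
    rw [← hx0]
    exact hV.cpa.nonneg hV.nonneg (hmem 0 (left_mem_Icc.2 hτ))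
  refine ⟨hy, ?_⟩
  set a := truncL2Norm τ fun t => S.h (x t)
  set b := truncL2Norm τ u
  have ha : 0 ≤ a := ENNReal.toReal_nonneg
  have hb : 0 ≤ b := ENNReal.toReal_nonneg
  have hγ := Real.sq_sqrt hV.gamma_pos.le
  have hV2 := Real.sq_sqrt (show 0 ≤ 2 * V x₀ by positivity)
  have h1 := Real.sqrt_nonneg γ
  have h2 := Real.sqrt_nonneg (2 * V x₀)
  refine (pow_le_pow_iff_left₀ ha (by positivity) two_ne_zero).1 ?_
  have h3 : 0 ≤ 2 * (Real.sqrt γ * b) * Real.sqrt (2 * V x₀) := by positivity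
  have h4 : (Real.sqrt γ * b + Real.sqrt (2 * V x₀)) ^ 2 =
      γ * b ^ 2 + 2 * V x₀ + 2 * (Real.sqrt γ * b) * Real.sqrt (2 * V x₀) := by
    rw [add_sq, mul_pow, hγ, hV2]
    ring
  rw [h4]
  linarith

section Barrier

variable {T : Triangulation n} {p : ℝ≥0∞} {A A₁ : Set (Fin n → ℝ)} {W : (Fin n → ℝ) → ℝ}
  {l : Fin T.N → Fin n → ℝ} {β gmax : Fin T.N → ℝ} {b₂ uMax c : ℝ}

/-- Solutions issued from the interior of `A` stay in `A` under admissible controls. -/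
theorem BarrierConditions.solution_mem (hW : S.BarrierConditions T p A₁ W l β gmax b₂ uMax)
    (hp1 : 1 ≤ p) (hp2 : p ≤ 2) (hb₂ : 0 < b₂) (hA : A = {x ∈ T.carrier | W x ≤ c})
    (hAc : ∀ x ∈ frontier A, W x = c) (hA₁ : IsClosed A₁) (hA₁A : A₁ ⊆ A)
    (hA₁T : A₁ ⊆ interior T.carrier) {x₀ : Fin n → ℝ} (hx₀ : x₀ ∈ interior A)
    {u : ℝ → Fin m → ℝ} {τ : ℝ} (hτ : 0 ≤ τ) (hu : ∀ t ∈ Icc 0 τ, ‖u t‖ ≤ uMax)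
    {x : ℝ → Fin n → ℝ} (hx : S.IsSolution x₀ u τ x) : ∀ t ∈ Icc 0 τ, x t ∈ A := by
  have hx0 := hx.apply_zero hτ
  refine hW.cpa.mem_sublevel hA hAc hA₁ hA₁A hA₁T hb₂ hx.integrable
    (fun t ht => by rw [hx0]; exact hx.eq t ht) (hx0 ▸ hx₀)
    (fun s hs _ i hi hsi => hW.dotProduct_le hp1 hp2 hi hsi (hu s hs)) fun t ht _ _ => ?_
  filter_upwards [self_mem_nhdsWithin] with s hs i hi hsi
  exact (hW.dotProduct_le hp1 hp2 hi hsi (hu s hs)).trans (by linarith)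

/-- Existence of global solutions. The vector fields are extended from `K ⊇ A` to bounded
continuous ones, for which Carathéodory's theorem applies. Since the extended fields still decrease
`W` near the common boundary points of `A` and `A₁`, by continuity, `A` is invariant for the
extended system, and the solution found solves the original one. -/
theorem BarrierConditions.exists_solution (hW : S.BarrierConditions T p A₁ W l β gmax b₂ uMax)
    (hp1 : 1 ≤ p) (hp2 : p ≤ 2) (hb₂ : 0 < b₂) (hA : A = {x ∈ T.carrier | W x ≤ c})
    (hAc : ∀ x ∈ frontier A, W x = c) (hA₁ : IsClosed A₁) (hA₁A : A₁ ⊆ A)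
    (hA₁T : A₁ ⊆ interior T.carrier) {K : Set (Fin n → ℝ)} (hK : IsCompact K) (hAK : A ⊆ K)
    (hKX : K ⊆ S.X) (hf : ∀ k, ContinuousOn (fun x => S.f x k) K)
    (hG : ∀ k r, ContinuousOn (fun x => S.G x k r) K) {x₀ : Fin n → ℝ} (hx₀ : x₀ ∈ interior A)
    {u : ℝ → Fin m → ℝ} (hu2 : MemL2e u) (hu : ∀ t, 0 ≤ t → ‖u t‖ ≤ uMax) :
    ∃ x : ℝ → Fin n → ℝ, ∀ τ, 0 ≤ τ → S.IsSolution x₀ u τ x := by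
  obtain ⟨φ, Cf, hφc, hφb, hφ⟩ := hK.exists_continuous_bounded_extension hf
  obtain ⟨ψ, Cg, hψc, hψb, hψ⟩ := hK.exists_continuous_bounded_extension
    (φ := fun x (kr : Fin n × Fin m) => S.G x kr.1 kr.2) fun kr => hG kr.1 kr.2
  set M : (Fin n → ℝ) → Matrix (Fin n) (Fin m) ℝ := fun x => Matrix.of fun k r => ψ x (k, r)
    with hM
  have hMc : Continuous M := continuous_matrix fun k r => (continuous_apply (k, r)).comp hψc
  have hMK : ∀ x ∈ K, M x = S.G x := by
    intro x hx
    ext k r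
    exact congr_fun (hψ hx) (k, r)
  set w : ℝ → Fin m → ℝ := (Ici 0).indicator u with hw
  have hwu : ∀ s, 0 ≤ s → w s = u s := fun s hs => indicator_of_mem hs u
  have hwb : ∀ s, ‖w s‖ ≤ uMax := by
    intro s
    by_cases hs : 0 ≤ s
    · rw [hwu s hs]
      exact hu s hs
    · rw [hw, indicator_of_notMem (by simpa using hs), norm_zero]
      exact hW.uMax_pos.le
  have hwm : AEMeasurable w volume := hu2.aemeasurable_indicator
  have hFjoint : Continuous fun z : (Fin n → ℝ) × (Fin m → ℝ) => φ z.1 + M z.1 *ᵥ z.2 :=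
    (hφc.comp continuous_fst).add ((hMc.comp continuous_fst).matrix_mulVec continuous_snd)
  have hFb : ∀ s x, ‖φ x + M x *ᵥ w s‖ ≤ ∑ k, (Cf k + ∑ r, Cg (k, r) * uMax) := by
    intro s x
    refine norm_le_sum_of_abs_le fun k => (abs_add_le (φ x k) ((M x *ᵥ w s) k)).trans
      (add_le_add (hφb x k) ?_)
    change |∑ r, ψ x (k, r) * w s r| ≤ _
    refine (Finset.abs_sum_le_sum_abs _ _).trans
      (Finset.sum_le_sum fun r _ => ?_)
    rw [abs_mul]
    exact mul_le_mul (hψb x (k, r)) ((norm_le_pi_norm (w s) r).trans (hwb s)) (abs_nonneg _)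
      ((abs_nonneg _).trans (hψb x (k, r)))
  obtain ⟨x, hxc, hx⟩ := exists_caratheodory_solution (F := fun s x => φ x + M x *ᵥ w s) hFb
    (fun s => hFjoint.comp (continuous_id.prodMk continuous_const))
    (fun y hy => by
      refine (hFjoint.measurable.comp_aemeasurable
        (hy.measurable.aemeasurable.prodMk hwm)).aestronglyMeasurable) x₀
  have hx0 : x 0 = x₀ := by simpa using hx 0 le_rfl
  have hint : ∀ τ, IntervalIntegrable (fun s => φ (x s) + M (x s) *ᵥ w s) volume 0 τ := by
    intro τ
    refine (intervalIntegrable_const (c := ∑ k, (Cf k + ∑ r, Cg (k, r) * uMax))).mono_fun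
      (hFjoint.measurable.comp_aemeasurable
        (hxc.measurable.aemeasurable.prodMk hwm)).aestronglyMeasurable.restrict ?_
    exact Eventually.of_forall fun s => (hFb s (x s)).trans (le_abs_self _)
  have hFA : ∀ s, 0 ≤ s → x s ∈ A →
      φ (x s) + M (x s) *ᵥ w s = S.f (x s) + S.G (x s) *ᵥ u s := by
    intro s hs hsA
    rw [hφ (hAK hsA), hMK _ (hAK hsA), hwu s hs]
  have hmem : ∀ τ, ∀ t ∈ Icc 0 τ, x t ∈ A := by
    intro τ
    refine hW.cpa.mem_sublevel hA hAc hA₁ hA₁A hA₁T hb₂ (hint τ)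
      (fun t ht => by rw [hx0]; exact hx t ht.1) (hx0 ▸ hx₀) (fun s hs hsA i hi hsi => ?_)
      fun t ht htA₁ _ => ?_
    · rw [hFA s hs.1 hsA]
      exact hW.dotProduct_le hp1 hp2 hi hsi (hu s hs.1)
    · have htK : x t ∈ K := hAK (hA₁A htA₁)
      have hev : ∀ i, x t ∈ T.simplex i → ¬ T.simplex i ⊆ A₁ →
          ∀ᶠ z in 𝓝 (x t), ∀ v ∈ Metric.closedBall (0 : Fin m → ℝ) uMax,
            gradCLM (T.grad W i) (φ z + M z *ᵥ v) < 0 := by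
        intro i hti hi
        refine (isCompact_closedBall _ _).eventually_forall_of_forall_eventually fun v hv => ?_
        refine ((gradCLM (T.grad W i)).continuous.comp hFjoint).continuousAt.eventually_lt
          continuousAt_const ?_
        have := hW.dotProduct_le hp1 hp2 hi hti (mem_closedBall_zero_iff.1 hv)
        simp only [Function.comp_apply, gradCLM_apply, hφ htK, hMK _ htK]
        linarith
      have hev' : ∀ᶠ s in 𝓝[Icc 0 τ] t, ∀ i, x t ∈ T.simplex i → ¬ T.simplex i ⊆ A₁ →
          ∀ v ∈ Metric.closedBall (0 : Fin m → ℝ) uMax,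
            gradCLM (T.grad W i) (φ (x s) + M (x s) *ᵥ v) < 0 := by
        simp only [eventually_all]
        exact fun i hti hi => (hxc.tendsto t |>.mono_left nhdsWithin_le_nhds).eventually
          (hev i hti hi)
      filter_upwards [hev', eventually_mem_imp_mem T.isClosed_simplex
        hxc.continuousWithinAt] with s hs hs' i hi hsi
      exact (hs i (hs' i hsi) hi _ (mem_closedBall_zero_iff.2 (hwb s))).le
  refine ⟨x, fun τ hτ => ⟨fun t ht => hKX (hAK (hmem τ t ht)), ?_, fun t ht => ?_⟩⟩
  · refine (hint τ).congr fun s hs => ?_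
    rw [uIoc_of_le hτ] at hs
    exact hFA s hs.1.le (hmem τ s (Ioc_subset_Icc_self hs))
  · rw [hx t ht.1]
    congr 1
    refine intervalIntegral.integral_congr fun s hs => ?_
    rw [uIcc_of_le ht.1] at hs
    exact hFA s hs.1 (hmem t s hs)

end Barrier

end ControlAffineSystem

theorem theorem3 {n m q : ℕ} (S : ControlAffineSystem n m q)
    (p : ℝ≥0∞) (hp1 : 1 ≤ p) (hp2 : p ≤ 2)
    -- the system
    (hX : IsRegularRegion S.X) (hf0 : S.f 0 = 0) (hh0 : S.h 0 = 0) (hg0 : S.gBar 0 = 0)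
    -- the storage function
    (Ω : Set (Fin n → ℝ)) (hΩ : IsRegularRegion Ω) (hΩX : Ω ⊆ S.X)
    (T : Triangulation n) (hT : T.carrier = Ω) (hT0 : T.BasedAtOrigin)
    (hf : ∀ k, T.PiecewiseC2 fun x => S.f x k)
    (hG : ∀ k r, T.PiecewiseC2 fun x => S.G x k r)
    (hh : ∀ k, T.PiecewiseC2 fun x => S.h x k)
    (V : (Fin n → ℝ) → ℝ) (l : Fin T.N → Fin n → ℝ) (β βh βg : Fin T.N → ℝ) (γ b₁ : ℝ)
    (hV : S.StorageConditions T p V l β βh βg γ b₁) (hb₁ : 0 < b₁)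
    -- the barrier function
    (Ω' : Set (Fin n → ℝ)) (hΩ' : IsRegularRegion Ω') (hΩ'X : Ω' ⊆ S.X)
    (T' : Triangulation n) (hT' : T'.carrier = Ω')
    (A₁ : Set (Fin n → ℝ)) (hA₁ : IsRegularRegion A₁)
    (hA₁T' : frontier A₁ ⊆ ⋃ i, frontier (T'.simplex i))
    (W : (Fin n → ℝ) → ℝ) (l' : Fin T'.N → Fin n → ℝ) (β' gmax : Fin T'.N → ℝ) (b₂ uMax : ℝ)
    (hW : S.BarrierConditions T' p A₁ W l' β' gmax b₂ uMax) (hb₂ : 0 < b₂)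
    -- the sublevel set, whose boundary is part of the level set
    (A : Set (Fin n → ℝ)) (c : ℝ) (hA : A = {x ∈ Ω' | W x ≤ c})
    (hAc : ∀ x ∈ frontier A, W x = c)
    (hA₁A : A₁ ⊆ A) (hA₁Ω' : A₁ ⊆ interior Ω') (hAΩ : A ⊆ Ω) :
    ∀ x₀ ∈ interior A,
      S.SmallSignalL2Stable x₀ uMax (Real.sqrt γ) (Real.sqrt (2 * V x₀)) := by
  intro x₀ hx₀
  have hA' : A = {x ∈ T'.carrier | W x ≤ c} := by rw [hT']; exact hA
  have hA₁T'' : A₁ ⊆ interior T'.carrier := by rw [hT']; exact hA₁Ω'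
  have hA₁c := hA₁.compact.isClosed
  refine ⟨fun u hu2 hu => ?_, fun u hu2 τ hτ hu x hx => ?_⟩
  · refine hW.exists_solution hp1 hp2 hb₂ hA' hAc hA₁c hA₁A hA₁T'' hΩ.compact hAΩ hΩX
      (fun k => ?_) (fun k r => ?_) hx₀ hu2 hu
    · rw [← hT]
      exact T.continuousOn_carrier fun i => (hf k i).continuousOn
    · rw [← hT]
      exact T.continuousOn_carrier fun i => (hG k r i).continuousOn
  · refine hV.gain hp1 hp2 hb₁ hf0 hh0 hg0 hT0 hh hτ (hu2 τ hτ) hx fun t ht => ?_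
    rw [hT]
    exact hAΩ (hW.solution_mem hp1 hp2 hb₂ hA' hAc hA₁c hA₁A hA₁T'' hx₀ hτ hu hx t ht)
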